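/- Let $\Sigma$ be a finite alphabet and let $L\subseteq\Sigma^*$ be a language. Formulas of $\mathbf{FO+MOD}[<]$ are built from the constants T and F, the atoms $Q_a x$ ($a\in\Sigma$) and $x<y$ with the boolean connectives, the quantifiers $\exists x$, $\forall x$ and the modular quantifiers $\exists^{i \bmod m}x$ ($m\ge 2$, $0\le i\le m-1$). They are interpreted in a word $w\in\Sigma^*$: variables range over the positions of $w$, $Q_a x$ means that position $x$ holds the letter $a$, $<$ is the order of positions, and $\exists^{i \bmod m}x\,\varphi$ means that the number of positions $x$ satisfying $\varphi$ is congruent to $i$ modulo $m$. $\mathbf{MOD}[<]$ consists of those formulas all of whose quantifiers are modular. $L$ is definable in one of these logics if $L=\{w\in\Sigma^* : w\models\varphi\}$ for some sentence $\varphi$ of that logic. The syntactic monoid $M(L)$ is the quotient of $\Sigma^*$ by the congruence $x\equiv_L y \iff (\forall u,v\in\Sigma^*:\ uxv\in L\Leftrightarrow uyv\in L)$. A subgroup of a monoid $M$ is a subset closed under multiplication that is a group under the multiplication of $M$ (its identity element need not be $1_M$); $M$ is called solvable if it is finite and all its subgroups are solvable groups. Then: 1. $L$ is $\mathbf{FO+MOD}[<]$-definable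 if and only if $M(L)$ is a solvable monoid. 2. $L$ is $\mathbf{MOD}[<]$-definable if and only if $M(L)$ is a finite solvable group. -/

import Mathlib

/-- Formulas of `FO+MOD[<]` over the alphabet `α` whose free variables are among `x_0, …, x_{n-1}`.
A quantifier in front of a formula with `n + 1` variables binds the last one, `x_n`. -/
inductive FOMod (α : Type*) : ℕ → Type _
  /-- The boolean constant `T`. -/
  | tru {n : ℕ} : FOMod α n
  /-- The boolean constant `F`. -/
  | fls {n : ℕ} : FOMod α n
  /-- `Q_a x_i`: the position `x_i` holds the letter `a`. -/
  | letter {n : ℕ} (a : α) (i : Fin n) : FOMod α n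
  /-- `x_i < x_j`. -/
  | lt {n : ℕ} (i j : Fin n) : FOMod α n
  | neg {n : ℕ} (φ : FOMod α n) : FOMod α n
  | and {n : ℕ} (φ ψ : FOMod α n) : FOMod α n
  | or {n : ℕ} (φ ψ : FOMod α n) : FOMod α n
  | ex {n : ℕ} (φ : FOMod α (n + 1)) : FOMod α n
  | all {n : ℕ} (φ : FOMod α (n + 1)) : FOMod α n
  /-- The modular quantifier `∃^{i mod m}`, where `m ≥ 2` and `0 ≤ i ≤ m - 1`. -/
  | modEx {n : ℕ} (i m : ℕ) (hm : 2 ≤ m) (hi : i < m) (φ : FOMod α (n + 1)) : FOMod α n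

namespace FOMod

variable {α : Type*}

/-- `φ.Holds w p`: the word structure `(w, p)` satisfies `φ`. Here `p` assigns to each variable a
position of `w`; positions are numbered from `0`. A simple extension of `(w, p)` is
`(w, Fin.snoc p q)`, where the position `q` is the value of the new variable. -/
def Holds (w : List α) : {n : ℕ} → FOMod α n → (Fin n → Fin w.length) → Prop
  | _, tru, _ => True
  | _, fls, _ => False
  | _, letter a i, p => w.get (p i) = a
  | _, lt i j, p => p i < p j
  | _, neg φ, p => ¬ φ.Holds w p
  | _, and φ ψ, p => φ.Holds w p ∧ ψ.Holds w p
  | _, or φ ψ, p => φ.Holds w p ∨ ψ.Holds w p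
  | n, ex φ, p => ∃ q : Fin w.length, φ.Holds w (Fin.snoc (α := fun _ : Fin (n + 1) => Fin w.length) p q)
  | n, all φ, p => ∀ q : Fin w.length, φ.Holds w (Fin.snoc (α := fun _ : Fin (n + 1) => Fin w.length) p q)
  | n, modEx i m _ _ φ, p =>
      {q : Fin w.length |
        φ.Holds w (Fin.snoc (α := fun _ : Fin (n + 1) => Fin w.length) p q)}.ncard % m = i

/-- All quantifiers of the formula are modular, i.e. it is a formula of `MOD[<]`. -/
def IsMod : {n : ℕ} → FOMod α n → Prop
  | _, tru => True
  | _, fls => True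
  | _, letter _ _ => True
  | _, lt _ _ => True
  | _, neg φ => φ.IsMod
  | _, and φ ψ => φ.IsMod ∧ ψ.IsMod
  | _, or φ ψ => φ.IsMod ∧ ψ.IsMod
  | _, ex _ => False
  | _, all _ => False
  | _, modEx _ _ _ _ φ => φ.IsMod

/-- The language `{w | w ⊨ φ}` of a sentence `φ`. -/
def language (φ : FOMod α 0) : Language α :=
  {w : List α | φ.Holds w Fin.elim0}

end FOMod

/-- `L` is defined by some sentence of `FO+MOD[<]`. -/
def IsFOModDefinable {α : Type*} (L : Language α) : Prop :=
  ∃ φ : FOMod α 0, φ.language = L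

/-- `L` is defined by some sentence of `MOD[<]`. -/
def IsModDefinable {α : Type*} (L : Language α) : Prop :=
  ∃ φ : FOMod α 0, φ.IsMod ∧ φ.language = L

/-- The syntactic congruence of `L`: `x ≡ y` iff `uxv ∈ L ↔ uyv ∈ L` for all words `u`, `v`. -/
def syntacticCon {α : Type*} (L : Language α) : Con (FreeMonoid α) where
  r x y := ∀ u v : FreeMonoid α,
    FreeMonoid.toList (u * x * v) ∈ L ↔ FreeMonoid.toList (u * y * v) ∈ L
  iseqv :=
    { refl := fun _ _ _ => Iff.rfl
      symm := fun h u v => (h u v).symm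
      trans := fun h k u v => (h u v).trans (k u v) }
  mul' := by
    intro x x' y y' hx hy u v
    have h1 := hx u (y * v)
    have h2 := hy (u * x') v
    simp only [mul_assoc] at h1 h2 ⊢
    exact h1.trans h2

/-- The syntactic monoid of `L`, with the monoid structure of a quotient by a congruence. -/
abbrev SyntacticMonoid {α : Type*} (L : Language α) : Type _ :=
  (syntacticCon L).Quotient

/-- `M` is a finite monoid all of whose subgroups are solvable. A subgroup of `M` is a subset
closed under multiplication that is a group for the multiplication of `M`; its identity element
may be any idempotent of `M`. -/
def IsSolvableMonoid (M : Type*) [Monoid M] : Prop :=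
  Finite M ∧ ∀ (S : Subsemigroup M) (G : Group S),
    (∀ a b : S, ((G.mul a b : S) : M) = (a : M) * (b : M)) → @Group.IsSolvable S G

/-- `M` is a finite solvable group: `M` is finite and its monoid structure is that of a
solvable group. -/
def IsFiniteSolvableGroup (M : Type*) [inst : Monoid M] : Prop :=
  Finite M ∧ ∃ G : Group M, G.toDivInvMonoid.toMonoid = inst ∧ @Group.IsSolvable M G

/-!
A formula of `FO+MOD[<]` is evaluated by multiplying in a finite monoid, and conversely products in
a finite monoid with solvable subgroups are computed by formulas.

*From formulas to monoids.* A formula with free variables is read on words whose positions are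
labelled by the variables that they carry. A quantifier multiplies, over all positions `q`, an
element of a commutative monoid `C` (`ZMod m` for a modular quantifier, `{0, 1}` for `∃`) that
depends on whether labelling `q` leads into the accepting set; this depends only on the letter at
`q` and on the products to its left and to its right, so it is evaluated in a block product of `C`
with the monoid `N` of the subformula (`IsRecognized.prod_quantifier`). In a subgroup of a block
product, the elements lying over the identity in `N` commute, because their weights multiply
pointwise in `C`. So the block product adds only one more step to the derived series
(`BlockProduct.hasSolvableSubgroups`), and it is a group if `N` and `C` are. The syntactic monoid is
a quotient of a submonoid of the resulting monoid, and subgroups of a quotient of a finite monoid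
lift to subgroups (`HasSolvableSubgroups.of_surjective`).

*From solvable groups to `MOD[<]`.* Let `K` be the last nontrivial term of the derived series of
`G`. By induction, the class modulo `K` of the value of a prefix is definable. Relative to coset
representatives, the product of a word telescopes into a product in the abelian group `K`, which is
determined by the numbers, modulo an exponent of `K`, of the positions with a given letter and a
given class of the prefix (`isDefinableLanguage_of_derivedSeries_eq_bot`).

*From solvable monoids to `FO+MOD[<]`.* The induction is on the size of `M` and then on the number
of letters that are not mapped to units. If all letters are mapped to units, the unit group, which
is solvable, does the work. Otherwise let `c` be a letter with `h c` not a unit. The blocks between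
consecutive occurrences of `c` are handled by the induction on letters. The product of everything
from the first to the last `c` lies in `h c * M ∩ M * h c`, the carrier of the local divisor at
`h c`, which is smaller than `M` and a quotient of a submonoid of `M`; it is the product in the
local divisor of a word over the alphabet `M` whose letters are the values of the blocks
(`map_prod_blocks`). That word is interpreted in the original one, with the occurrences of `c` as
its positions, so formulas about it translate (`FOMod.exists_interpretation`,
`IsDefinableLanguage.suffixTransduction`).
-/

universe u

open scoped commutatorElement

/-! ### Monoids with solvable subgroups -/

/-- All subgroups of `M` are solvable, phrased through multiplicative maps `f : G → M` from groups:
the normal subgroup `{g | f g = f 1}` contains a term of the derived series of `G`. The image of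
such an `f` is a subgroup of `M`, with identity `f 1`. -/
def HasSolvableSubgroups (M : Type u) [Monoid M] : Prop :=
  ∀ (G : Type u) [Group G] (f : G →ₙ* M), ∃ n, ∀ g ∈ derivedSeries G n, f g = f 1

namespace MulHom

variable {G : Type*} [Group G] {M : Type*} [Semigroup M]

/-- The image of a group under a multiplicative map into a semigroup is a group. -/
noncomputable abbrev srangeGroup (f : G →ₙ* M) : Group f.srange :=
  letI : One f.srange := ⟨⟨f 1, 1, rfl⟩⟩
  letI : Inv f.srange := ⟨fun s => ⟨f s.2.choose⁻¹, _, rfl⟩⟩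
  Group.ofLeftAxioms mul_assoc
    (by
      rintro ⟨_, g, rfl⟩
      exact Subtype.ext ((map_mul f 1 g).symm.trans (by rw [one_mul])))
    (by
      intro s
      refine Subtype.ext ?_
      calc f s.2.choose⁻¹ * s.1 = f s.2.choose⁻¹ * f s.2.choose :=
            congrArg _ s.2.choose_spec.symm
        _ = f 1 := by rw [← map_mul, inv_mul_cancel])

/-- The elements that `f` identifies with `1` form a subgroup. -/
def oneFiber (f : G →ₙ* M) : Subgroup G where
  carrier := {g | f g = f 1}
  one_mem' := rfl
  mul_mem' {a b} ha hb := by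
    change f (a * b) = f 1
    rw [map_mul, show f a = f 1 from ha, show f b = f 1 from hb, ← map_mul, one_mul]
  inv_mem' {a} ha := by
    change f a⁻¹ = f 1
    have h : f a = f 1 := ha
    calc f a⁻¹ = f 1 * f a⁻¹ := by rw [← map_mul, one_mul]
      _ = f 1 := by rw [← h, ← map_mul, mul_inv_cancel, h]

/-- A step of the derived series is gained where `f` cannot tell `a * b` from `b * a`. -/
theorem derivedSeries_succ_of_comm (f : G →ₙ* M) {n : ℕ}
    (h : ∀ a ∈ derivedSeries G n, ∀ b ∈ derivedSeries G n, f (a * b) = f (b * a)) :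
    ∀ g ∈ derivedSeries G (n + 1), f g = f 1 := by
  have : derivedSeries G (n + 1) ≤ f.oneFiber := by
    rw [derivedSeries_succ, Subgroup.commutator_le]
    intro a ha b hb
    change f ⁅a, b⁆ = f 1
    rw [commutatorElement_def, mul_assoc, map_mul, h a ha b hb, ← map_mul]
    congr 1; group
  exact fun g hg => this hg

/-- If the image of `f`, as a group, is solvable, then `f` is trivial on a term of the derived
series. -/
theorem exists_derivedSeries_of_isSolvable_srange (f : G →ₙ* M)
    (h : @Group.IsSolvable f.srange f.srangeGroup) :
    ∃ n, ∀ g ∈ derivedSeries G n, f g = f 1 := by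
  let := f.srangeGroup
  obtain ⟨n, hn⟩ := h
  refine ⟨n, fun g hg => ?_⟩
  let F : G →* f.srange := MonoidHom.mk' (fun g => ⟨f g, g, rfl⟩)
    (fun a b => Subtype.ext (map_mul f a b))
  have h1 : F g ∈ derivedSeries f.srange n :=
    map_derivedSeries_le_derivedSeries F n (Subgroup.mem_map_of_mem F hg)
  rw [hn, Subgroup.mem_bot] at h1
  exact congrArg Subtype.val h1

end MulHom

theorem HasSolvableSubgroups.isSolvable {M : Type u} [Monoid M] (h : HasSolvableSubgroups M)
    {G : Type u} [Group G] (f : G →ₙ* M) (hf : Function.Injective f) : Group.IsSolvable G := by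
  obtain ⟨n, hn⟩ := h G f
  exact ⟨n, (Subgroup.eq_bot_iff_forall _).2 fun g hg => hf (hn g hg)⟩

theorem isSolvableMonoid_iff {M : Type*} [Monoid M] :
    IsSolvableMonoid M ↔ Finite M ∧ HasSolvableSubgroups M := by
  refine and_congr_right fun _ => ⟨fun h G _ f => ?_, fun h S G hS => ?_⟩
  · exact f.exists_derivedSeries_of_isSolvable_srange (h _ _ fun _ _ => rfl)
  · exact h.isSolvable (⟨Subtype.val, hS⟩ : S →ₙ* M) Subtype.val_injective

theorem HasSolvableSubgroups.of_comm {M : Type*} [CommMonoid M] : HasSolvableSubgroups M :=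
  fun _ _ f => ⟨1, f.derivedSeries_succ_of_comm fun a _ b _ => by
    rw [map_mul, map_mul, mul_comm]⟩

theorem HasSolvableSubgroups.of_isSolvable {G : Type*} [Group G] [hG : Group.IsSolvable G] :
    HasSolvableSubgroups G := by
  intro H _ f
  obtain ⟨n, hn⟩ := hG
  have h1 : f 1 = 1 := by
    have : f 1 * f 1 = f 1 := by rw [← map_mul, one_mul]
    exact mul_eq_left.1 this
  let F : H →* G := MonoidHom.mk' f (map_mul f)
  refine ⟨n, fun g hg => ?_⟩
  have h2 : F g ∈ derivedSeries G n :=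
    map_derivedSeries_le_derivedSeries F n (Subgroup.mem_map_of_mem F hg)
  rw [hn, Subgroup.mem_bot] at h2
  exact h2.trans h1.symm

theorem HasSolvableSubgroups.submonoid {M : Type*} [Monoid M] (h : HasSolvableSubgroups M)
    (P : Submonoid M) : HasSolvableSubgroups P := by
  intro G _ f
  obtain ⟨n, hn⟩ := h G ((P.subtype : P →ₙ* M).comp f)
  exact ⟨n, fun g hg => Subtype.ext (hn g hg)⟩

theorem HasSolvableSubgroups.prod {M N : Type} [Monoid M] [Monoid N]
    (hM : HasSolvableSubgroups M) (hN : HasSolvableSubgroups N) :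
    HasSolvableSubgroups (M × N) := by
  intro G _ f
  obtain ⟨m, hm⟩ := hM G ((MonoidHom.fst M N : M × N →ₙ* M).comp f)
  obtain ⟨n, hn⟩ := hN G ((MonoidHom.snd M N : M × N →ₙ* N).comp f)
  exact ⟨max m n, fun g hg => Prod.ext
    (hm g (derivedSeries_antitone G (le_max_left _ _) hg))
    (hn g (derivedSeries_antitone G (le_max_right _ _) hg))⟩

/-- A nonempty semigroup in which all translations are surjective is a group. -/
theorem exists_group_of_surjective_mul {T : Type*} [hT : Semigroup T] [Nonempty T]
    (hl : ∀ a b : T, ∃ x, a * x = b) (hr : ∀ a b : T, ∃ x, x * a = b) :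
    ∃ G : Group T, G.toDivInvMonoid.toMonoid.toSemigroup = hT := by
  obtain ⟨t⟩ := ‹Nonempty T›
  obtain ⟨e, he⟩ := hl t t
  have hone : ∀ s : T, s * e = s := by
    intro s
    obtain ⟨x, rfl⟩ := hr t s
    rw [mul_assoc, he]
  choose i hi using fun s => hl s e
  let : One T := ⟨e⟩
  let : Inv T := ⟨i⟩
  exact ⟨Group.ofRightAxioms mul_assoc hone hi, rfl⟩

/-- Subgroups of a quotient of a finite monoid are quotients of subgroups: a minimal subsemigroup
that is mapped onto the given subgroup is itself a group. -/
theorem HasSolvableSubgroups.of_surjective {N M : Type*} [Monoid N] [Monoid M] [Finite N]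
    (h : HasSolvableSubgroups N) (π : N →* M) (hπ : Function.Surjective π) :
    HasSolvableSubgroups M := by
  intro G _ f
  let C : Set (Subsemigroup N) := {T | T.map (π : N →ₙ* M) = f.srange}
  have hC : C.Nonempty := by
    refine ⟨f.srange.comap (π : N →ₙ* M), ?_⟩
    exact Subsemigroup.map_comap_eq_of_surjective hπ _
  obtain ⟨T, hT, hmin⟩ := C.toFinite.exists_minimal hC
  have hmem : ∀ t ∈ T, ∃ g, f g = π t := fun t ht => by
    have : π t ∈ f.srange := hT ▸ Subsemigroup.mem_map_of_mem (π : N →ₙ* M) ht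
    exact this
  have hlift : ∀ g, ∃ t ∈ T, π t = f g := fun g => by
    have : f g ∈ T.map (π : N →ₙ* M) := by rw [hT]; exact ⟨g, rfl⟩
    exact this
  -- `a * T` is a subsemigroup of `T` with the same image under `π`, so it is `T` by minimality.
  have hl : ∀ a b : T, ∃ x, a * x = b := by
    rintro ⟨a, ha⟩ ⟨b, hb⟩
    let T' : Subsemigroup N :=
      { carrier := {y | ∃ x ∈ T, a * x = y}
        mul_mem' := by
          rintro _ _ ⟨x, hx, rfl⟩ ⟨y, hy, rfl⟩
          exact ⟨x * (a * y), T.mul_mem hx (T.mul_mem ha hy), by simp only [mul_assoc]⟩ }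
    have h1 : T' ≤ T := by
      rintro _ ⟨x, hx, rfl⟩
      exact T.mul_mem ha hx
    have h2 : T' ∈ C := by
      refine le_antisymm (((Subsemigroup.gc_map_comap (π : N →ₙ* M)).monotone_l h1).trans hT.le) ?_
      rintro _ ⟨g, rfl⟩
      obtain ⟨g0, hg0⟩ := hmem a ha
      obtain ⟨x, hx, hxg⟩ := hlift (g0⁻¹ * g)
      refine ⟨a * x, ⟨x, hx, rfl⟩, ?_⟩
      change π (a * x) = f g
      rw [map_mul, hxg, ← hg0, ← map_mul, mul_inv_cancel_left]
    obtain ⟨x, hx, hxb⟩ := hmin h2 h1 hb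
    exact ⟨⟨x, hx⟩, Subtype.ext hxb⟩
  have hr : ∀ a b : T, ∃ x, x * a = b := by
    rintro ⟨a, ha⟩ ⟨b, hb⟩
    let T' : Subsemigroup N :=
      { carrier := {y | ∃ x ∈ T, x * a = y}
        mul_mem' := by
          rintro _ _ ⟨x, hx, rfl⟩ ⟨y, hy, rfl⟩
          exact ⟨x * a * y, T.mul_mem (T.mul_mem hx ha) hy, by simp only [mul_assoc]⟩ }
    have h1 : T' ≤ T := by
      rintro _ ⟨x, hx, rfl⟩
      exact T.mul_mem hx ha
    have h2 : T' ∈ C := by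
      refine le_antisymm (((Subsemigroup.gc_map_comap (π : N →ₙ* M)).monotone_l h1).trans hT.le) ?_
      rintro _ ⟨g, rfl⟩
      obtain ⟨g0, hg0⟩ := hmem a ha
      obtain ⟨x, hx, hxg⟩ := hlift (g * g0⁻¹)
      refine ⟨x * a, ⟨x, hx, rfl⟩, ?_⟩
      change π (x * a) = f g
      rw [map_mul, hxg, ← hg0, ← map_mul, inv_mul_cancel_right]
    obtain ⟨x, hx, hxb⟩ := hmin h2 h1 hb
    exact ⟨⟨x, hx⟩, Subtype.ext hxb⟩
  obtain ⟨t, ht, -⟩ := hlift 1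
  have : Nonempty T := ⟨⟨t, ht⟩⟩
  obtain ⟨GT, hGT⟩ := exists_group_of_surjective_mul hl hr
  have hmul : ∀ a b : T, ((a * b : T) : N) = a * b := fun a b => by
    have : (GT.toDivInvMonoid.toMonoid.toSemigroup.mul a b) = ⟨a * b, T.mul_mem a.2 b.2⟩ := by
      rw [hGT]; rfl
    exact congrArg Subtype.val this
  have hsol : Group.IsSolvable T :=
    h.isSolvable (⟨Subtype.val, hmul⟩ : T →ₙ* N) Subtype.val_injective
  apply f.exists_derivedSeries_of_isSolvable_srange
  let := f.srangeGroup
  let F : T →* f.srange := MonoidHom.mk' (fun t => ⟨π t, hmem t t.2⟩)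
    (fun a b => Subtype.ext (by
      change π ((a * b : T) : N) = π a * π b
      rw [hmul, map_mul]))
  refine Group.isSolvable_of_surjective (f := F) ?_
  rintro ⟨_, g, rfl⟩
  obtain ⟨t, ht, htg⟩ := hlift g
  exact ⟨⟨t, ht⟩, Subtype.ext htg⟩

/-! ### Block products -/

/-- The block product of a commutative monoid `C` and a monoid `N`: pairs of an element of `N` and a
function `N × N → C`, on which `N` acts from both sides by translating the arguments. -/
@[ext]
structure BlockProduct (C N : Type*) where
  base : N
  weight : N → N → C

namespace BlockProduct

variable {C N : Type*} [CommMonoid C] [Monoid N]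

instance : Monoid (BlockProduct C N) where
  mul u v := ⟨u.base * v.base, fun x y => u.weight x (v.base * y) * v.weight (x * u.base) y⟩
  one := ⟨1, fun _ _ => 1⟩
  mul_assoc u v w := by
    ext x y
    · exact mul_assoc _ _ _
    · change u.weight x (v.base * (w.base * y)) * v.weight (x * u.base) (w.base * y) * _ =
        u.weight x (v.base * w.base * y) * (_ * w.weight (x * u.base * v.base) y)
      simp only [mul_assoc]
      rfl
  one_mul u := by
    ext x y
    · exact one_mul _
    · change 1 * u.weight (x * 1) y = _
      simp
  mul_one u := by
    ext x y
    · exact mul_one _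
    · change u.weight x (1 * y) * 1 = _
      simp

@[simp] theorem base_mul (u v : BlockProduct C N) : (u * v).base = u.base * v.base := rfl

@[simp] theorem weight_mul (u v : BlockProduct C N) (x y : N) :
    (u * v).weight x y = u.weight x (v.base * y) * v.weight (x * u.base) y := rfl

@[simp] theorem base_one : (1 : BlockProduct C N).base = 1 := rfl

@[simp] theorem weight_one (x y : N) : (1 : BlockProduct C N).weight x y = 1 := rfl

/-- The projection of the block product onto its base. -/
def baseHom (C N : Type*) [CommMonoid C] [Monoid N] : BlockProduct C N →* N where
  toFun := base
  map_one' := rfl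
  map_mul' _ _ := rfl

instance [Finite C] [Finite N] : Finite (BlockProduct C N) :=
  Finite.of_injective (fun u : BlockProduct C N => (u.base, u.weight)) fun _ _ h =>
    BlockProduct.ext (congrArg Prod.fst h) (congrArg Prod.snd h)

theorem base_list_prod (l : List (BlockProduct C N)) : l.prod.base = (l.map base).prod :=
  map_list_prod (baseHom C N) l

/-- The weight of a product collects the weights of its factors, evaluated at the products of what
stands to their left and to their right. -/
theorem weight_list_prod (l : List (BlockProduct C N)) (x y : N) :
    l.prod.weight x y = ∏ i : Fin l.length, (l.get i).weight
      (x * ((l.map base).take i).prod) (((l.map base).drop (i + 1)).prod * y) := by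
  induction l generalizing x with
  | nil => simp
  | cons a l ih =>
    rw [List.prod_cons, weight_mul, ih, base_list_prod]
    refine Eq.trans ?_ (Fin.prod_univ_succ (n := l.length) _).symm
    simp [mul_assoc]

/-- On the elements of a subgroup that have the same base as its identity, the weights multiply
pointwise, up to a translation, so that these elements commute. -/
theorem hasSolvableSubgroups {C N : Type} [CommMonoid C] [Monoid N] (h : HasSolvableSubgroups N) :
    HasSolvableSubgroups (BlockProduct C N) := by
  intro G _ f
  obtain ⟨n, hn⟩ := h G ((baseHom C N : BlockProduct C N →ₙ* N).comp f)
  refine ⟨n + 1, f.derivedSeries_succ_of_comm fun a ha b hb => ?_⟩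
  have key : ∀ a ∈ derivedSeries G n, ∀ b ∈ derivedSeries G n,
      f (a * b) = f 1 * (f a * f b) * f 1 := fun a _ b _ => by
    rw [← map_mul, ← map_mul, ← map_mul, one_mul, mul_one]
  have hbase : ∀ a ∈ derivedSeries G n, (f a).base = (f 1).base := hn
  have hidem : (f 1).base * (f 1).base = (f 1).base := by
    rw [← base_mul, ← map_mul, one_mul]
  rw [key a ha b hb, key b hb a ha]
  ext x y
  · simp [hbase a ha, hbase b hb]
  · simp only [weight_mul, base_mul, hbase a ha, hbase b hb, mul_assoc, hidem]
    congr 1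
    rw [← mul_assoc, ← mul_assoc, mul_comm (weight (f a) _ _)]

/-- If `C` has finite exponent, then the block product with a torsion monoid is torsion. -/
theorem isOfFinOrder {m : ℕ} (hm : 0 < m) (hC : ∀ c : C, c ^ m = 1) (hN : ∀ a : N, IsOfFinOrder a) :
    ∀ u : BlockProduct C N, IsOfFinOrder u := by
  intro u
  obtain ⟨k, hk, hku⟩ := (isOfFinOrder_iff_pow_eq_one).1 (hN u.base)
  refine isOfFinOrder_iff_pow_eq_one.2 ⟨k * m, Nat.mul_pos hk hm, ?_⟩
  have hb : (u ^ k).base = 1 := (map_pow (baseHom C N) u k).trans hku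
  have hp : ∀ j : ℕ, ∀ x y, ((u ^ k) ^ j).base = 1 ∧
      ((u ^ k) ^ j).weight x y = (u ^ k).weight x y ^ j := by
    intro j x y
    induction j with
    | zero => simp
    | succ j ih => rw [pow_succ, base_mul, weight_mul, ih.1, hb, one_mul, one_mul, mul_one, ih.2,
        pow_succ]; exact ⟨rfl, rfl⟩
  rw [pow_mul]
  ext x y
  · exact (hp m 1 1).1
  · rw [(hp m _ _).2, hC]; rfl

end BlockProduct

/-! ### Recognition of formulas by finite monoids -/

section Recognition

variable {α : Type*}

/-- The product in `N` of the values `η` of the letters of `w`, where the position `i` is labelled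
by its letter and by the set of those variables that `p` maps to `i`. -/
def wordValue {N : Type*} [Monoid N] {n : ℕ} (η : α → (Fin n → Prop) → N) (w : List α)
    (p : Fin n → Fin w.length) : N :=
  (List.ofFn fun i : Fin w.length => η (w.get i) fun j => p j = i).prod

/-- The relation `R` between words and `n` positions is recognized by a finite monoid with solvable
subgroups. If `b` holds, this monoid is moreover required to be a group. -/
def IsRecognized (b : Prop) {n : ℕ} (R : ∀ w : List α, (Fin n → Fin w.length) → Prop) : Prop :=
  ∃ (N : Type) (_ : Monoid N), Finite N ∧ HasSolvableSubgroups N ∧ (b → ∀ x : N, IsOfFinOrder x) ∧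
    ∃ (η : α → (Fin n → Prop) → N) (X : Set N), ∀ w p, R w p ↔ wordValue η w p ∈ X

namespace IsRecognized

variable {b : Prop} {n : ℕ} {R S : ∀ w : List α, (Fin n → Fin w.length) → Prop}

theorem congr (hR : IsRecognized b R) (h : ∀ w p, S w p ↔ R w p) : IsRecognized b S := by
  obtain rfl : S = R := by
    funext w p
    exact propext (h w p)
  exact hR

theorem const (b : Prop) (P : Prop) :
    IsRecognized b (fun (w : List α) (_ : Fin n → Fin w.length) => P) :=
  ⟨Unit, inferInstance, inferInstance, .of_comm, fun _ x => isOfFinOrder_of_finite x,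
    fun _ _ => 1, {_x | P}, fun _ _ => Iff.rfl⟩

theorem not (hR : IsRecognized b R) : IsRecognized b fun w p => ¬ R w p := by
  obtain ⟨N, _, h1, h2, h3, η, X, h⟩ := hR
  exact ⟨N, _, h1, h2, h3, η, Xᶜ, fun w p => not_congr (h w p)⟩

theorem and (hR : IsRecognized b R) (hS : IsRecognized b S) :
    IsRecognized b fun w p => R w p ∧ S w p := by
  obtain ⟨M, _, h1, h2, h3, η, X, h⟩ := hR
  obtain ⟨N, _, k1, k2, k3, θ, Y, k⟩ := hS
  refine ⟨M × N, inferInstance, inferInstance, h2.prod k2,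
    fun hb x => (h3 hb x.1).prod_mk (k3 hb x.2), fun a B => (η a B, θ a B), X ×ˢ Y, fun w p => ?_⟩
  have e1 : (wordValue (fun a B => (η a B, θ a B)) w p).1 = wordValue η w p := by
    change MonoidHom.fst M N _ = _
    rw [wordValue, map_list_prod, List.map_ofFn]
    rfl
  have e2 : (wordValue (fun a B => (η a B, θ a B)) w p).2 = wordValue θ w p := by
    change MonoidHom.snd M N _ = _
    rw [wordValue, map_list_prod, List.map_ofFn]
    rfl
  rw [Set.mem_prod, e1, e2]
  exact and_congr (h w p) (k w p)

/-- A position and its letter are recognized by counting modulo `2` the positions that carry this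
variable and this letter. -/
theorem letter (b : Prop) (a : α) (i : Fin n) :
    IsRecognized b fun (w : List α) (p : Fin n → Fin w.length) => w.get (p i) = a := by
  classical
  refine ⟨Multiplicative (ZMod 2), inferInstance, inferInstance, .of_comm,
    fun _ x => isOfFinOrder_of_finite x,
    fun c B => if B i ∧ c = a then .ofAdd 1 else 1, {.ofAdd 1}, fun w p => ?_⟩
  rw [wordValue, List.prod_ofFn, Finset.prod_eq_single (p i)]
  · by_cases h : w.get (p i) = a
    · simp only [h, and_self, if_true, Set.mem_singleton_iff]
    · simp only [h, and_false, if_false, Set.mem_singleton_iff, false_iff]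
      decide
  · intro q _ hq
    exact if_neg fun h => hq h.1.symm
  · simp

/-- The block product of two groups of order `2` counts the positions marked by `j` that have an odd
number of positions marked by `i` to their left. -/
theorem lt (b : Prop) (i j : Fin n) :
    IsRecognized b fun (w : List α) (p : Fin n → Fin w.length) => p i < p j := by
  classical
  let C := Multiplicative (ZMod 2)
  let g : C := .ofAdd 1
  have hg : g ≠ 1 := by decide
  let η : α → (Fin n → Prop) → BlockProduct C C := fun _ B =>
    ⟨if B i then g else 1, fun x _ => if B j ∧ x = g then g else 1⟩
  refine ⟨BlockProduct C C, inferInstance, inferInstance,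
    BlockProduct.hasSolvableSubgroups .of_comm,
    fun _ => BlockProduct.isOfFinOrder (m := 2) two_pos (by decide)
      fun x => isOfFinOrder_of_finite x,
    η, {u | u.weight 1 1 = g}, fun w p => ?_⟩
  have key : (wordValue η w p).weight 1 1 = if p i < p j then g else 1 := by
    rw [wordValue, BlockProduct.weight_list_prod, List.map_ofFn]
    rw [← (finCongr (List.length_ofFn (f := fun q : Fin w.length =>
      η (w.get q) fun k => p k = q))).symm.prod_comp]
    rw [Finset.prod_eq_single (p j)]
    · have hpre : (List.take (p j) (List.ofFn fun q : Fin w.length =>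
          (η (w.get q) fun k => p k = q).base)).prod = if p i < p j then g else 1 := by
        rw [List.prod_take_ofFn]
        by_cases h : p i < p j
        · rw [Finset.prod_eq_single (p i)]
          · simp [η, h]
          · intro q _ hq
            exact if_neg hq.symm
          · simp [h]
        · rw [if_neg h]
          refine Finset.prod_eq_one fun q hq => if_neg fun e => h ?_
          rw [e]
          simpa using hq
      simp only [List.get_ofFn, Function.comp_def, finCongr_symm_apply, Fin.val_cast, Fin.cast_cast,
        Fin.cast_eq_self, hpre, one_mul]
      by_cases h : p i < p j
      · simp [η, h]
      · simp [η, h, hg.symm]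
    · intro q _ hq
      simp [η, hq.symm]
    · simp
  change _ ↔ _ = g
  rw [key]
  by_cases h : p i < p j
  · simp [h]
  · simp [h, hg.symm]

/-- A commutative product over all values of a variable is evaluated in a block product: the letter
at position `q` contributes `c` if relabelling this one position, between the given left and right
products, leads into the accepting set. -/
theorem prod_quantifier {C : Type} [CommMonoid C] [Finite C]
    {R : ∀ w : List α, (Fin (n + 1) → Fin w.length) → Prop}
    (hC : b → ∃ m, 0 < m ∧ ∀ x : C, x ^ m = 1) (c : C) (Y : Set C) (hR : IsRecognized b R) :
    IsRecognized b fun (w : List α) (p : Fin n → Fin w.length) => by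
      classical exact (∏ q : Fin w.length,
        if R w (Fin.snoc (α := fun _ => Fin w.length) p q) then c else 1) ∈ Y := by
  classical
  obtain ⟨N, _, h1, h2, h3, η, X, h⟩ := hR
  let s : (Fin n → Prop) → Prop → (Fin (n + 1) → Prop) :=
    fun B x => Fin.snoc (α := fun _ => Prop) B x
  let θ : α → (Fin n → Prop) → BlockProduct C N := fun a B =>
    ⟨η a (s B False), fun x y => if x * η a (s B True) * y ∈ X then c else 1⟩
  refine ⟨BlockProduct C N, inferInstance, inferInstance, BlockProduct.hasSolvableSubgroups h2,
    fun hb => ?_, θ, {u | u.weight 1 1 ∈ Y}, fun w p => ?_⟩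
  · obtain ⟨m, hm, hm'⟩ := hC hb
    exact BlockProduct.isOfFinOrder hm hm' (h3 hb)
  · change _ ↔ _ ∈ Y
    rw [wordValue, BlockProduct.weight_list_prod, List.map_ofFn]
    rw [← (finCongr (List.length_ofFn (f := fun q : Fin w.length =>
      θ (w.get q) fun k => p k = q))).symm.prod_comp]
    refine iff_of_eq (congrArg (· ∈ Y) (Finset.prod_congr rfl fun q _ => ?_))
    have hlist : (List.ofFn fun i : Fin w.length => η (w.get i) fun j =>
        (Fin.snoc (α := fun _ => Fin w.length) p q : Fin (n + 1) → Fin w.length) j = i) =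
        (List.ofFn fun i : Fin w.length => η (w.get i) (s (fun k => p k = i) False)).set q
          (η (w.get q) (s (fun k => p k = q) True)) := by
      apply List.ext_get (by simp)
      intro i hi hi'
      have hs : ∀ i : Fin w.length, (fun j =>
          (Fin.snoc (α := fun _ => Fin w.length) p q : Fin (n + 1) → Fin w.length) j = i) =
          s (fun k => p k = i) (q = i) := by
        intro i
        funext j
        refine Fin.lastCases ?_ (fun j => ?_) j <;> simp [s]
      simp only [hs, List.get_eq_getElem, List.getElem_set, List.getElem_ofFn]
      split_ifs with hqi
      · subst hqi
        simp
      · have : ¬ q = ⟨i, by simpa using hi⟩ := fun e => hqi (congrArg Fin.val e)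
        simp [this]
    have hval : R w (Fin.snoc (α := fun _ => Fin w.length) p q) ↔
        ((List.ofFn fun i : Fin w.length => η (w.get i) (s (fun k => p k = i) False)).take q).prod *
          η (w.get q) (s (fun k => p k = q) True) *
        ((List.ofFn fun i : Fin w.length =>
          η (w.get i) (s (fun k => p k = i) False)).drop (q + 1)).prod ∈ X := by
      rw [h, wordValue, hlist, List.prod_set]
      simp
    simp only [hval]
    simp [θ, Function.comp_def]

theorem ex (hb : ¬ b) {R : ∀ w : List α, (Fin (n + 1) → Fin w.length) → Prop}
    (hR : IsRecognized b R) :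
    IsRecognized b fun (w : List α) (p : Fin n → Fin w.length) =>
      ∃ q, R w (Fin.snoc (α := fun _ => Fin w.length) p q) := by
  -- The multiplicative monoid `{0, 1}` detects whether some factor is `0`.
  refine (prod_quantifier (C := ZMod 2) (fun h => absurd h hb) 0 {0} hR).congr fun w p => ?_
  simp [Finset.prod_eq_zero_iff]

theorem modEx (i m : ℕ) (hm : 2 ≤ m) (hi : i < m)
    {R : ∀ w : List α, (Fin (n + 1) → Fin w.length) → Prop} (hR : IsRecognized b R) :
    IsRecognized b fun (w : List α) (p : Fin n → Fin w.length) =>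
      {q : Fin w.length | R w (Fin.snoc (α := fun _ => Fin w.length) p q)}.ncard % m = i := by
  classical
  have : NeZero m := ⟨by omega⟩
  refine (prod_quantifier (C := Multiplicative (ZMod m)) (fun _ => ⟨m, by omega, fun x => ?_⟩)
    (.ofAdd 1) {.ofAdd (i : ZMod m)} hR).congr fun w p => ?_
  · apply Multiplicative.toAdd.injective
    simp
  · rw [Finset.prod_ite, Finset.prod_const, Finset.prod_const_one, mul_one, Set.mem_singleton_iff,
      ← ofAdd_nsmul, Multiplicative.ofAdd.injective.eq_iff, nsmul_one, ZMod.natCast_eq_natCast_iff',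
      Nat.mod_eq_of_lt hi, Set.ncard_eq_toFinset_card']
    simp

end IsRecognized

theorem FOMod.isRecognized (b : Prop) {n : ℕ} (φ : FOMod α n) (hφ : b → φ.IsMod) :
    IsRecognized b fun w p => φ.Holds w p := by
  induction φ with
  | tru => exact .const b True
  | fls => exact .const b False
  | letter a i => exact .letter b a i
  | lt i j => exact .lt b i j
  | neg φ ih => exact (ih hφ).not
  | and φ ψ ih1 ih2 => exact (ih1 fun h => (hφ h).1).and (ih2 fun h => (hφ h).2)
  | or φ ψ ih1 ih2 =>
    exact ((ih1 fun h => (hφ h).1).not.and (ih2 fun h => (hφ h).2).not).not.congr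
      fun w p => or_iff_not_and_not
  | ex φ ih => exact (ih fun h => (hφ h).elim).ex hφ
  | all φ ih =>
    refine ((ih fun h => (hφ h).elim).not.ex hφ).not.congr fun w p => ?_
    exact not_exists_not.symm
  | modEx i m hm hi φ ih => exact (ih hφ).modEx i m hm hi

/-- The syntactic monoid of a recognized language is a quotient of a submonoid of the recognizing
monoid. -/
theorem syntacticMonoid_of_isRecognized {L : Language α} {b : Prop}
    (h : IsRecognized b fun (w : List α) (_ : Fin 0 → Fin w.length) => w ∈ L) :
    Finite (SyntacticMonoid L) ∧ HasSolvableSubgroups (SyntacticMonoid L) ∧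
      (b → ∀ x : SyntacticMonoid L, IsOfFinOrder x) := by
  obtain ⟨N, _, h1, h2, h3, η, X, h⟩ := h
  let f : FreeMonoid α →* N := FreeMonoid.lift fun a => η a Fin.elim0
  have hf : ∀ w : FreeMonoid α, FreeMonoid.toList w ∈ L ↔ f w ∈ X := by
    intro w
    refine (h _ Fin.elim0).trans ?_
    rw [wordValue, FreeMonoid.lift_apply]
    have : (List.ofFn fun i : Fin (FreeMonoid.toList w).length =>
        η ((FreeMonoid.toList w).get i) fun j => Fin.elim0 j = i) =
        (FreeMonoid.toList w).map fun a => η a Fin.elim0 := by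
      rw [← List.ofFn_get ((FreeMonoid.toList w).map fun a => η a Fin.elim0)]
      apply List.ext_get (by simp)
      intro i _ _
      simp only [List.get_eq_getElem, List.getElem_ofFn, List.getElem_map]
      exact congrArg _ (funext fun j => j.elim0)
    rw [this]
  have hle : Con.ker f ≤ syntacticCon L := by
    intro x y hxy u v
    have hxy : f x = f y := hxy
    rw [hf, hf, map_mul, map_mul, map_mul, map_mul, hxy]
  let π : MonoidHom.mrange f →* SyntacticMonoid L :=
    (Con.map _ _ hle).comp (Con.quotientKerEquivRange f).symm.toMonoidHom
  have hπ : Function.Surjective π := by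
    refine Function.Surjective.comp (g := Con.map _ _ hle) ?_
      (Con.quotientKerEquivRange f).symm.surjective
    intro x
    obtain ⟨x, rfl⟩ := Con.mk'_surjective x
    exact ⟨(x : (Con.ker f).Quotient), rfl⟩
  refine ⟨.of_surjective π hπ, (h2.submonoid _).of_surjective π hπ, fun hb x => ?_⟩
  obtain ⟨y, rfl⟩ := hπ x
  exact π.isOfFinOrder ((Submonoid.isOfFinOrder_coe).1 (h3 hb y))

end Recognition

/-! ### Definable relations and interpretations -/

/-- The relation `R` between words and `n` positions is defined by a formula of `FO+MOD[<]`, which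
is required to be a formula of `MOD[<]` if `b` holds. -/
def IsDefinable {α : Type*} (b : Prop) {n : ℕ}
    (R : ∀ w : List α, (Fin n → Fin w.length) → Prop) : Prop :=
  ∃ φ : FOMod α n, (b → φ.IsMod) ∧ ∀ w p, φ.Holds w p ↔ R w p

/-- The language `S` is defined by a sentence of `FO+MOD[<]`, or of `MOD[<]` if `b` holds. -/
def IsDefinableLanguage {α : Type*} (b : Prop) (S : Set (List α)) : Prop :=
  IsDefinable b fun (w : List α) (_ : Fin 0 → Fin w.length) => w ∈ S

/-- Substitution of the variables `x_i` by `x_{f i}`. -/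
def FOMod.rename {α : Type*} : {n m : ℕ} → (Fin n → Fin m) → FOMod α n → FOMod α m
  | _, _, _, tru => tru
  | _, _, _, fls => fls
  | _, _, f, letter a i => letter a (f i)
  | _, _, f, lt i j => lt (f i) (f j)
  | _, _, f, neg φ => neg (φ.rename f)
  | _, _, f, and φ ψ => and (φ.rename f) (ψ.rename f)
  | _, _, f, or φ ψ => or (φ.rename f) (ψ.rename f)
  | _, m, f, ex φ => ex (φ.rename (Fin.snoc (α := fun _ => Fin (m + 1))
      (Fin.castSucc ∘ f) (Fin.last m)))
  | _, m, f, all φ => all (φ.rename (Fin.snoc (α := fun _ => Fin (m + 1))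
      (Fin.castSucc ∘ f) (Fin.last m)))
  | _, m, f, modEx i k hk hi φ => modEx i k hk hi (φ.rename (Fin.snoc (α := fun _ => Fin (m + 1))
      (Fin.castSucc ∘ f) (Fin.last m)))

theorem snoc_comp_snoc_castSucc {P : Type*} {n m : ℕ} (f : Fin n → Fin m) (p : Fin m → P) (q : P) :
    (Fin.snoc (α := fun _ => P) p q : Fin (m + 1) → P) ∘
      (Fin.snoc (α := fun _ => Fin (m + 1)) (Fin.castSucc ∘ f) (Fin.last m) :
        Fin (n + 1) → Fin (m + 1)) =
      Fin.snoc (α := fun _ => P) (p ∘ f) q := by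
  funext j
  refine Fin.lastCases ?_ (fun j => ?_) j <;> simp

theorem FOMod.holds_rename {α : Type*} {n : ℕ} (φ : FOMod α n) {m : ℕ} (f : Fin n → Fin m)
    (w : List α) (p : Fin m → Fin w.length) : (φ.rename f).Holds w p ↔ φ.Holds w (p ∘ f) := by
  induction φ generalizing m with
  | tru | fls | letter a i | lt i j => exact Iff.rfl
  | neg φ ih => exact not_congr (ih f p)
  | and φ ψ ih1 ih2 => exact and_congr (ih1 f p) (ih2 f p)
  | or φ ψ ih1 ih2 => exact or_congr (ih1 f p) (ih2 f p)
  | ex φ ih =>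
    refine exists_congr fun q => ?_
    rw [ih, snoc_comp_snoc_castSucc]
  | all φ ih =>
    refine forall_congr' fun q => ?_
    rw [ih, snoc_comp_snoc_castSucc]
  | modEx i k hk hi φ ih => simp only [rename, Holds, ih, snoc_comp_snoc_castSucc]

theorem FOMod.isMod_rename {α : Type*} {n : ℕ} (φ : FOMod α n) {m : ℕ} (f : Fin n → Fin m)
    (h : φ.IsMod) : (φ.rename f).IsMod := by
  induction φ generalizing m with
  | tru | fls | letter a i | lt i j => trivial
  | neg φ ih => exact ih f h
  | and φ ψ ih1 ih2 => exact ⟨ih1 f h.1, ih2 f h.2⟩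
  | or φ ψ ih1 ih2 => exact ⟨ih1 f h.1, ih2 f h.2⟩
  | ex φ ih | all φ ih => exact h.elim
  | modEx i k hk hi φ ih => exact ih _ h

namespace IsDefinable

variable {α : Type*} {b : Prop} {n : ℕ} {R S : ∀ w : List α, (Fin n → Fin w.length) → Prop}

theorem congr (hR : IsDefinable b R) (h : ∀ w p, S w p ↔ R w p) : IsDefinable b S := by
  obtain ⟨φ, h1, h2⟩ := hR
  exact ⟨φ, h1, fun w p => (h2 w p).trans (h w p).symm⟩

theorem const (b : Prop) (P : Prop) :
    IsDefinable b (fun (w : List α) (_ : Fin n → Fin w.length) => P) := by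
  by_cases hP : P
  · exact ⟨.tru, fun _ => trivial, fun _ _ => iff_of_true trivial hP⟩
  · exact ⟨.fls, fun _ => trivial, fun _ _ => iff_of_false id hP⟩

theorem letter (b : Prop) (a : α) (i : Fin n) :
    IsDefinable b fun (w : List α) (p : Fin n → Fin w.length) => w.get (p i) = a :=
  ⟨.letter a i, fun _ => trivial, fun _ _ => Iff.rfl⟩

theorem lt (b : Prop) (i j : Fin n) :
    IsDefinable b fun (w : List α) (p : Fin n → Fin w.length) => p i < p j :=
  ⟨.lt i j, fun _ => trivial, fun _ _ => Iff.rfl⟩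

theorem not (hR : IsDefinable b R) : IsDefinable b fun w p => ¬ R w p := by
  obtain ⟨φ, h1, h2⟩ := hR
  exact ⟨.neg φ, h1, fun w p => not_congr (h2 w p)⟩

theorem and (hR : IsDefinable b R) (hS : IsDefinable b S) :
    IsDefinable b fun w p => R w p ∧ S w p := by
  obtain ⟨φ, h1, h2⟩ := hR
  obtain ⟨ψ, k1, k2⟩ := hS
  exact ⟨.and φ ψ, fun hb => ⟨h1 hb, k1 hb⟩, fun w p => and_congr (h2 w p) (k2 w p)⟩

theorem or (hR : IsDefinable b R) (hS : IsDefinable b S) :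
    IsDefinable b fun w p => R w p ∨ S w p := by
  obtain ⟨φ, h1, h2⟩ := hR
  obtain ⟨ψ, k1, k2⟩ := hS
  exact ⟨.or φ ψ, fun hb => ⟨h1 hb, k1 hb⟩, fun w p => or_congr (h2 w p) (k2 w p)⟩

theorem ex (hb : ¬ b) {R : ∀ w : List α, (Fin (n + 1) → Fin w.length) → Prop}
    (hR : IsDefinable b R) :
    IsDefinable b fun (w : List α) (p : Fin n → Fin w.length) =>
      ∃ q, R w (Fin.snoc (α := fun _ => Fin w.length) p q) := by
  obtain ⟨φ, h1, h2⟩ := hR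
  exact ⟨.ex φ, fun h => absurd h hb, fun w p => exists_congr fun q => h2 w _⟩

theorem modEx (i m : ℕ) (hm : 2 ≤ m) (hi : i < m)
    {R : ∀ w : List α, (Fin (n + 1) → Fin w.length) → Prop} (hR : IsDefinable b R) :
    IsDefinable b fun (w : List α) (p : Fin n → Fin w.length) =>
      {q : Fin w.length | R w (Fin.snoc (α := fun _ => Fin w.length) p q)}.ncard % m = i := by
  obtain ⟨φ, h1, h2⟩ := hR
  exact ⟨.modEx i m hm hi φ, h1, fun w p => by simp only [FOMod.Holds, h2]⟩

theorem rename {m : ℕ} (f : Fin n → Fin m) (hR : IsDefinable b R) :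
    IsDefinable b fun (w : List α) (p : Fin m → Fin w.length) => R w (p ∘ f) := by
  obtain ⟨φ, h1, h2⟩ := hR
  exact ⟨φ.rename f, fun hb => φ.isMod_rename f (h1 hb), fun w p =>
    (φ.holds_rename f w p).trans (h2 w _)⟩

theorem exists_finite {ι : Type*} [Finite ι] {R : ι → ∀ w : List α, (Fin n → Fin w.length) → Prop}
    (hR : ∀ i, IsDefinable b (R i)) : IsDefinable b fun w p => ∃ i, R i w p := by
  classical
  have := Fintype.ofFinite ι
  have key : ∀ s : Finset ι, IsDefinable b fun w p => ∃ i ∈ s, R i w p := by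
    intro s
    induction s using Finset.induction_on with
    | empty => exact (const b False).congr fun w p => by simp
    | insert i s _ ih => exact ((hR i).or ih).congr fun w p => by simp
  exact (key Finset.univ).congr fun w p => by simp

theorem forall_finite {ι : Type*} [Finite ι] {R : ι → ∀ w : List α, (Fin n → Fin w.length) → Prop}
    (hR : ∀ i, IsDefinable b (R i)) : IsDefinable b fun w p => ∀ i, R i w p :=
  (exists_finite fun i => (hR i).not).not.congr fun w p => by simp

end IsDefinable

/-- The map `e` identifies the positions of `w'` with those positions of `w` that have a label, in
increasing order, so that the letter of `w'` at `i` is the label of `e i`. Here `ψ c q` means that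
the position `q` of `w` has the label `c`. -/
structure IsInterpretation {α β : Type*} {w : List α} {w' : List β} (ψ : β → Fin w.length → Prop)
    (e : Fin w'.length → Fin w.length) : Prop where
  strictMono : StrictMono e
  label : ∀ i c, ψ c (e i) ↔ w'.get i = c
  range : ∀ q c, ψ c q → ∃ i, e i = q

section Interpretation

variable {α β : Type*} [Finite β] {b : Prop}

/-- Quantifiers over positions of the interpreted word `w'` become quantifiers over the labelled
positions of `w`. The maps `κ` and `ν` say where the parameters of the labelling and the
variables of the formula are found among the variables of the translation. -/
theorem FOMod.exists_interpretation {k : ℕ}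
    {Ψ : β → ∀ w : List α, (Fin (k + 1) → Fin w.length) → Prop} (hΨ : ∀ c, IsDefinable b (Ψ c))
    {n : ℕ} (φ : FOMod β n) (hφ : b → φ.IsMod) {N : ℕ} (κ : Fin k → Fin N) (ν : Fin n → Fin N) :
    ∃ R : ∀ w : List α, (Fin N → Fin w.length) → Prop, IsDefinable b R ∧
      ∀ (w : List α) (w' : List β) (e : Fin w'.length → Fin w.length) (s : Fin N → Fin w.length)
        (r : Fin n → Fin w'.length),
        IsInterpretation (fun c q => Ψ c w (Fin.snoc (α := fun _ => Fin w.length) (s ∘ κ) q)) e →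
        s ∘ ν = e ∘ r → (R w s ↔ φ.Holds w' r) := by
  -- The labelling of the last variable, in a context with one more variable.
  have hlabel : ∀ {N : ℕ} (κ : Fin k → Fin N) (c : β), IsDefinable b
      fun (w : List α) (s : Fin (N + 1) → Fin w.length) =>
        Ψ c w (Fin.snoc (α := fun _ => Fin w.length) (s ∘ Fin.castSucc ∘ κ) (s (Fin.last N))) := by
    intro N κ c
    refine ((hΨ c).rename (Fin.snoc (α := fun _ => Fin (N + 1)) (Fin.castSucc ∘ κ)
      (Fin.last N))).congr fun w s => iff_of_eq (congrArg _ ?_)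
    funext j
    refine Fin.lastCases ?_ (fun j => ?_) j <;> simp
  have hext : ∀ {N n L L' : ℕ} (ν : Fin n → Fin N) (e : Fin L' → Fin L)
      (s : Fin N → Fin L) (r : Fin n → Fin L') (j : Fin L'), s ∘ ν = e ∘ r →
      (Fin.snoc (α := fun _ => Fin L) s (e j) : Fin (N + 1) → Fin L) ∘
        (Fin.snoc (α := fun _ => Fin (N + 1)) (Fin.castSucc ∘ ν) (Fin.last N) :
          Fin (n + 1) → Fin (N + 1)) =
        e ∘ (Fin.snoc (α := fun _ => Fin L') r j : Fin (n + 1) → Fin L') := by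
    intro N n L L' ν e s r j h
    rw [snoc_comp_snoc_castSucc, h]
    funext i
    refine Fin.lastCases ?_ (fun i => ?_) i <;> simp
  have hparam : ∀ {N L : ℕ} (κ : Fin k → Fin N) (s : Fin N → Fin L) (q : Fin L),
      (Fin.snoc (α := fun _ => Fin L) s q : Fin (N + 1) → Fin L) ∘ Fin.castSucc ∘ κ = s ∘ κ := by
    intro N L κ s q
    funext i
    simp
  induction φ generalizing N with
  | tru => exact ⟨_, .const b True, fun _ _ _ _ _ _ _ => Iff.rfl⟩
  | fls => exact ⟨_, .const b False, fun _ _ _ _ _ _ _ => Iff.rfl⟩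
  | letter a i =>
    refine ⟨_, (hΨ a).rename (Fin.snoc (α := fun _ => Fin N) κ (ν i)), fun w w' e s r he hs => ?_⟩
    have h1 : s ∘ (Fin.snoc (α := fun _ => Fin N) κ (ν i) : Fin (k + 1) → Fin N) =
        Fin.snoc (α := fun _ => Fin w.length) (s ∘ κ) (e (r i)) := by
      funext j
      refine Fin.lastCases ?_ (fun j => ?_) j
      · simpa using congrFun hs i
      · simp
    rw [h1]
    exact he.label (r i) a
  | lt i j =>
    refine ⟨_, .lt b (ν i) (ν j), fun w w' e s r he hs => ?_⟩
    rw [show s (ν i) = e (r i) from congrFun hs i, show s (ν j) = e (r j) from congrFun hs j]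
    exact he.strictMono.lt_iff_lt
  | neg φ ih =>
    obtain ⟨R, h1, h2⟩ := ih hφ κ ν
    exact ⟨_, h1.not, fun w w' e s r he hs => not_congr (h2 w w' e s r he hs)⟩
  | and φ ψ ih1 ih2 =>
    obtain ⟨R, h1, h2⟩ := ih1 (fun hb => (hφ hb).1) κ ν
    obtain ⟨S, k1, k2⟩ := ih2 (fun hb => (hφ hb).2) κ ν
    exact ⟨_, h1.and k1, fun w w' e s r he hs =>
      and_congr (h2 w w' e s r he hs) (k2 w w' e s r he hs)⟩
  | or φ ψ ih1 ih2 =>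
    obtain ⟨R, h1, h2⟩ := ih1 (fun hb => (hφ hb).1) κ ν
    obtain ⟨S, k1, k2⟩ := ih2 (fun hb => (hφ hb).2) κ ν
    exact ⟨_, h1.or k1, fun w w' e s r he hs =>
      or_congr (h2 w w' e s r he hs) (k2 w w' e s r he hs)⟩
  | ex φ ih =>
    obtain ⟨R, h1, h2⟩ := ih (fun hb => (hφ hb).elim) (Fin.castSucc ∘ κ)
      (Fin.snoc (α := fun _ => Fin (N + 1)) (Fin.castSucc ∘ ν) (Fin.last N))
    refine ⟨_, .ex (fun hb => (hφ hb).elim) ((IsDefinable.exists_finite (hlabel κ)).and h1),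
      fun w w' e s r he hs => ?_⟩
    have hR := fun j => h2 w w' e _ (Fin.snoc (α := fun _ => Fin w'.length) r j)
      (by simpa only [hparam] using he) (hext ν e s r j hs)
    simp only [hparam, Fin.snoc_last]
    constructor
    · rintro ⟨q, ⟨c, hc⟩, hq⟩
      obtain ⟨j, rfl⟩ := he.range q c hc
      exact ⟨j, (hR j).1 hq⟩
    · rintro ⟨j, hj⟩
      exact ⟨e j, ⟨_, (he.label j _).2 rfl⟩, (hR j).2 hj⟩
  | all φ ih =>
    obtain ⟨R, h1, h2⟩ := ih (fun hb => (hφ hb).elim) (Fin.castSucc ∘ κ)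
      (Fin.snoc (α := fun _ => Fin (N + 1)) (Fin.castSucc ∘ ν) (Fin.last N))
    refine ⟨_, (IsDefinable.ex (fun hb => (hφ hb).elim)
      ((IsDefinable.exists_finite (hlabel κ)).and h1.not)).not, fun w w' e s r he hs => ?_⟩
    have hR := fun j => h2 w w' e _ (Fin.snoc (α := fun _ => Fin w'.length) r j)
      (by simpa only [hparam] using he) (hext ν e s r j hs)
    simp only [hparam, Fin.snoc_last]
    constructor
    · intro h j
      by_contra hj
      exact h ⟨e j, ⟨_, (he.label j _).2 rfl⟩, fun h => hj ((hR j).1 h)⟩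
    · rintro h ⟨q, ⟨c, hc⟩, hq⟩
      obtain ⟨j, rfl⟩ := he.range q c hc
      exact hq ((hR j).2 (h j))
  | modEx i m hm hi φ ih =>
    obtain ⟨R, h1, h2⟩ := ih hφ (Fin.castSucc ∘ κ)
      (Fin.snoc (α := fun _ => Fin (N + 1)) (Fin.castSucc ∘ ν) (Fin.last N))
    refine ⟨_, .modEx i m hm hi ((IsDefinable.exists_finite (hlabel κ)).and h1),
      fun w w' e s r he hs => ?_⟩
    have hR := fun j => h2 w w' e _ (Fin.snoc (α := fun _ => Fin w'.length) r j)
      (by simpa only [hparam] using he) (hext ν e s r j hs)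
    simp only [hparam, Fin.snoc_last, FOMod.Holds]
    rw [← Set.ncard_image_of_injective _ he.strictMono.injective]
    refine iff_of_eq (congrArg (fun S : Set (Fin w.length) => S.ncard % m = i) ?_)
    ext q
    constructor
    · rintro ⟨⟨c, hc⟩, hq⟩
      obtain ⟨j, rfl⟩ := he.range q c hc
      exact ⟨j, (hR j).1 hq, rfl⟩
    · rintro ⟨j, hj, rfl⟩
      exact ⟨⟨_, (he.label j _).2 rfl⟩, (hR j).2 hj⟩

/-- If the words `T w p` are interpreted in `w` by definable labels with parameters `p`, then
membership of `T w p` in a definable language is a definable relation. -/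
theorem IsDefinableLanguage.interpret {S : Set (List β)} (hS : IsDefinableLanguage b S) {k : ℕ}
    {Ψ : β → ∀ w : List α, (Fin (k + 1) → Fin w.length) → Prop} (hΨ : ∀ c, IsDefinable b (Ψ c))
    (T : ∀ w : List α, (Fin k → Fin w.length) → List β)
    (hT : ∀ w p, ∃ e : Fin (T w p).length → Fin w.length,
      IsInterpretation (fun c q => Ψ c w (Fin.snoc (α := fun _ => Fin w.length) p q)) e) :
    IsDefinable b fun w p => T w p ∈ S := by
  obtain ⟨φ, h1, h2⟩ := hS
  obtain ⟨R, hR, h⟩ := φ.exists_interpretation hΨ h1 id Fin.elim0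
  refine hR.congr fun w p => ?_
  obtain ⟨e, he⟩ := hT w p
  exact (h2 _ Fin.elim0).symm.trans (h w _ e p Fin.elim0 he (funext fun i => i.elim0)).symm

end Interpretation

namespace IsDefinableLanguage

variable {α : Type*} {b : Prop} {S S' : Set (List α)}

theorem take [Finite α] (hS : IsDefinableLanguage b S) :
    IsDefinable b fun (w : List α) (p : Fin 1 → Fin w.length) => w.take (p 0) ∈ S := by
  refine hS.interpret (fun c => (IsDefinable.letter b c 1).and (IsDefinable.lt b 1 0)) _
    fun w p => ⟨fun i => ⟨i, (i.2.trans_le (List.length_take_le' _ _))⟩, ?_, ?_, ?_⟩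
  · exact fun i j h => h
  · intro i c
    have hi := i.2
    have hi' : (i : ℕ) < p 0 := by simp only [List.length_take] at hi; omega
    simp [Fin.snoc, Fin.lt_def, hi']
  · intro q c hq
    have h : q < p 0 := by simpa [Fin.snoc] using hq.2
    exact ⟨⟨q, by simpa using h⟩, rfl⟩

theorem drop [Finite α] (hS : IsDefinableLanguage b S) :
    IsDefinable b fun (w : List α) (p : Fin 1 → Fin w.length) => w.drop (p 0 + 1) ∈ S := by
  refine hS.interpret (fun c => (IsDefinable.letter b c 1).and (IsDefinable.lt b 0 1)) _
    fun w p => ⟨fun i => ⟨p 0 + 1 + i, ?_⟩, ?_, ?_, ?_⟩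
  · have hi := i.2
    simp only [List.length_drop] at hi
    omega
  · intro i j h
    exact Nat.add_lt_add_left h _
  · intro i c
    have hi' : (p 0 : ℕ) < p 0 + 1 + i := by omega
    refine (and_iff_left hi').trans ?_
    simp [Fin.snoc]
  · intro q c hq
    have h : p 0 < q := by simpa [Fin.snoc] using hq.2
    have h : (p 0 : ℕ) < q := h
    exact ⟨⟨q - (p 0 + 1), by simp only [List.length_drop]; omega⟩, Fin.ext (by simp; omega)⟩

/-- Definable languages are closed under the marked product `S c S'`. -/
theorem markedProduct [Finite α] (hb : ¬ b) (hS : IsDefinableLanguage b S) (c : α)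
    (hS' : IsDefinableLanguage b S') : IsDefinableLanguage b
      {w | ∃ x : Fin w.length, w.get x = c ∧ w.take x ∈ S ∧ w.drop (x + 1) ∈ S'} :=
  (IsDefinable.ex hb ((IsDefinable.letter b c 0).and (hS.take.and hS'.drop))).congr
    fun w p => by simp [Fin.snoc]

theorem ncard_prefix [Finite α] (hS : IsDefinableLanguage b S) (c : α) {i m : ℕ} (hm : 2 ≤ m)
    (hi : i < m) :
    IsDefinableLanguage b
      {w | {x : Fin w.length | w.get x = c ∧ w.take x ∈ S}.ncard % m = i} :=
  (IsDefinable.modEx i m hm hi ((IsDefinable.letter b c 0).and hS.take)).congr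
    fun w p => by simp [Fin.snoc]

/-- A language is definable if membership depends only on finitely many finite-valued functions with
definable fibres. -/
theorem of_determined {ι T : Type*} [Finite ι] [Finite T] {F : ι → List α → T}
    (hF : ∀ i t, IsDefinableLanguage b {w | F i w = t})
    (hS : ∀ w w', (∀ i, F i w = F i w') → w ∈ S → w' ∈ S) : IsDefinableLanguage b S := by
  refine (IsDefinable.exists_finite fun κ : ι → T =>
    (IsDefinable.const b (∃ w ∈ S, ∀ i, F i w = κ i)).and
      (IsDefinable.forall_finite fun i => hF i (κ i))).congr fun w p => ?_
  constructor
  · exact fun hw => ⟨fun i => F i w, ⟨w, hw, fun _ => rfl⟩, fun _ => rfl⟩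
  · rintro ⟨κ, ⟨w', hw', h1⟩, h2⟩
    exact hS w' w (fun i => (h1 i).trans (h2 i).symm) hw'

end IsDefinableLanguage

/-- The word over `β` obtained from a word over `α` by replacing every letter `a` by `F a v`, where
`v` is the suffix that follows `a`; letters with `F a v = none` are deleted. -/
def suffixTransduction {α β : Type*} (F : α → List α → Option β) : List α → List β
  | [] => []
  | a :: v => (F a v).toList ++ suffixTransduction F v

/-- The transduced word is interpreted in `w` on the positions that are not deleted. -/
theorem exists_isInterpretation_suffixTransduction {α β : Type*} (F : α → List α → Option β)
    (w : List α) : ∃ e : Fin (suffixTransduction F w).length → Fin w.length,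
      IsInterpretation (fun c q => F (w.get q) (w.drop (q + 1)) = some c) e := by
  induction w with
  | nil => exact ⟨fun i => i, fun i => i.elim0, fun i => i.elim0, fun i => i.elim0⟩
  | cons a v ih =>
    obtain ⟨e, he⟩ := ih
    cases h : F a v with
    | none =>
      have h1 : suffixTransduction F (a :: v) = suffixTransduction F v := by
        simp [suffixTransduction, h]
      rw [h1]
      refine ⟨fun i => (e i).succ, fun i j hij => Fin.succ_lt_succ_iff.2 (he.strictMono hij),
        fun i c => he.label i c, fun q c => ?_⟩
      refine Fin.cases (fun hq => ?_) (fun q hq => ?_) q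
      · simp [h] at hq
      · obtain ⟨i, rfl⟩ := he.range q c hq
        exact ⟨i, rfl⟩
    | some t =>
      have h1 : suffixTransduction F (a :: v) = t :: suffixTransduction F v := by
        simp [suffixTransduction, h]
      rw [h1]
      refine ⟨Fin.cases (motive := fun _ => Fin (v.length + 1)) 0 fun i => (e i).succ,
        fun i j => ?_, fun i c => ?_, fun q c => ?_⟩
      · refine Fin.cases (fun hij => ?_) (fun j hij => ?_) j
        · exact absurd hij (Fin.not_lt_zero _)
        · revert hij
          refine Fin.cases (fun _ => ?_) (fun i hij => ?_) i
          · exact Fin.succ_pos _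
          · exact Fin.succ_lt_succ_iff.2 (he.strictMono (Fin.succ_lt_succ_iff.1 hij))
      · refine Fin.cases ?_ (fun i => ?_) i
        · simp [h]
        · exact he.label i c
      · refine Fin.cases (fun _ => ⟨0, rfl⟩) (fun q hq => ?_) q
        obtain ⟨i, rfl⟩ := he.range q c hq
        exact ⟨i.succ, rfl⟩

theorem IsDefinableLanguage.suffixTransduction {α β : Type*} [Finite β] {b : Prop}
    {S : Set (List β)} (hS : IsDefinableLanguage b S) {F : α → List α → Option β}
    (hF : ∀ c, IsDefinable b fun (w : List α) (p : Fin 1 → Fin w.length) =>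
      F (w.get (p 0)) (w.drop (p 0 + 1)) = some c) :
    IsDefinableLanguage b {w | suffixTransduction F w ∈ S} := by
  refine hS.interpret hF (fun w _ => _root_.suffixTransduction F w) fun w p => ?_
  obtain ⟨e, he⟩ := exists_isInterpretation_suffixTransduction F w
  exact ⟨e, by simpa [Fin.snoc] using he⟩

/-! ### Languages recognized by finite solvable groups -/

theorem List.prod_map_eq_of_count_mod_eq {T K : Type*} [CommMonoid K] [BEq T] [LawfulBEq T] {m : ℕ}
    (hK : ∀ x : K, x ^ m = 1) (k : T → K) {l l' : List T}
    (h : ∀ t, l.count t % m = l'.count t % m) : (l.map k).prod = (l'.map k).prod := by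
  let : DecidableEq T := instDecidableEqOfLawfulBEq
  have count_congr : ∀ (l₀ : List T) (t : T),
      @List.count T instBEqOfDecidableEq t l₀ = l₀.count t := fun l₀ t => by
    congr 1
    exact lawful_beq_subsingleton _ _
  have key : ∀ l₀ : List T, l₀.toFinset ⊆ l.toFinset ∪ l'.toFinset →
      (l₀.map k).prod = ∏ t ∈ l.toFinset ∪ l'.toFinset, k t ^ (l₀.count t % m) := by
    intro l₀ h₀
    rw [Finset.prod_list_map_count]
    simp only [count_congr l₀]
    refine (Finset.prod_subset h₀ fun t _ ht => ?_).trans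
      (Finset.prod_congr rfl fun t _ => pow_eq_pow_mod _ (hK _))
    rw [List.count_eq_zero_of_not_mem fun h => ht (List.mem_toFinset.2 h), pow_zero]
  rw [key l Finset.subset_union_left, key l' Finset.subset_union_right]
  exact Finset.prod_congr rfl fun t _ => by rw [h t]

section PrefixTrace

variable {α Q : Type*} [Monoid Q]

/-- The run of the right multiplication automaton of `π : α → Q` from the state `q`: the list of the
pairs consisting of a letter and of the state in which it is read. -/
def prefixTrace (π : α → Q) : Q → List α → List (Q × α)
  | _, [] => []
  | q, a :: w => (q, a) :: prefixTrace π (q * π a) w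

theorem count_prefixTrace [DecidableEq Q] [DecidableEq α] (π : α → Q) (q q' : Q) (a : α)
    (w : List α) : (prefixTrace π q w).count (q', a) =
      {x : Fin w.length | w.get x = a ∧ q * ((w.take x).map π).prod = q'}.ncard := by
  have key : (prefixTrace π q w).count (q', a) =
      (Finset.univ.filter fun x : Fin w.length =>
        w.get x = a ∧ q * ((w.take x).map π).prod = q').card := by
    induction w generalizing q with
    | nil => rfl
    | cons c w ih =>
      rw [prefixTrace, List.count_cons, ih]
      refine Eq.trans ?_ (Fin.card_filter_univ_succ (n := w.length) _).symm
      simp only [List.get_eq_getElem, List.length_cons, Fin.val_zero, List.getElem_cons_zero,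
        List.take_zero, List.map_nil, List.prod_nil, mul_one, Fin.val_succ,
        List.getElem_cons_succ, List.take_succ_cons, List.map_cons, List.prod_cons, mul_assoc,
        beq_iff_eq, Prod.mk.injEq, and_comm (a := q = q')]
      split_ifs <;> rfl
  rw [key, Set.ncard_eq_toFinset_card']
  simp

end PrefixTrace

/-- Relative to coset representatives `s` of the normal subgroup `N`, the product of a word
telescopes into a product of elements of `N`, each of which is determined by a letter and by the
class modulo `N` of the prefix in front of it. -/
theorem prod_prefixTrace {α G : Type*} [Group G] (N : Subgroup G) [N.Normal] (s : G ⧸ N → G)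
    (h : α → G) (q : G ⧸ N) (w : List α) :
    ((prefixTrace (fun a => (h a : G ⧸ N)) q w).map
      fun v => s v.1 * h v.2 * (s (v.1 * (h v.2 : G ⧸ N)))⁻¹).prod =
      s q * (w.map h).prod * (s (q * ((w.map h).prod : G)))⁻¹ := by
  induction w generalizing q with
  | nil => simp [prefixTrace]
  | cons a w ih =>
    rw [prefixTrace, List.map_cons, List.prod_cons, ih]
    simp [mul_assoc]

/-- If the last term `K` of the derived series is abelian, then a product over a word is determined
by its class modulo `K` and by the numbers, modulo an exponent of `K`, of the positions with a
given letter and a given class of the prefix. -/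
theorem isDefinableLanguage_of_derivedSeries_eq_bot {α : Type*} [Finite α] (b : Prop) (n : ℕ)
    (G : Type*) [Group G] [Finite G] (hG : derivedSeries G n = ⊥) (h : α → G) (g : G) :
    IsDefinableLanguage b {w | (w.map h).prod = g} := by
  classical
  induction n generalizing G with
  | zero =>
    have : Subsingleton G := (Subgroup.subsingleton_iff).1
      (subsingleton_iff_bot_eq_top.1 (hG.symm.trans (derivedSeries_zero G)))
    exact (IsDefinable.const b True).congr fun w p => iff_of_true (Subsingleton.elim _ _) trivial
  | succ n ih =>
    set K := derivedSeries G n with hK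
    let Q := G ⧸ K
    have hQ : derivedSeries Q n = ⊥ := by
      rw [← map_derivedSeries_eq (f := QuotientGroup.mk' K) (QuotientGroup.mk'_surjective K) n,
        ← hK, Subgroup.map_eq_bot_iff, QuotientGroup.ker_mk']
    have hcomm : ∀ x y : K, x * y = y * x := by
      intro x y
      have : ⁅(x : G), (y : G)⁆ ∈ derivedSeries G (n + 1) := by
        rw [derivedSeries_succ]
        exact Subgroup.commutator_mem_commutator x.2 y.2
      rw [hG, Subgroup.mem_bot, commutatorElement_eq_one_iff_mul_comm] at this
      exact Subtype.ext this
    let : CommGroup K := { (inferInstance : Group K) with mul_comm := hcomm }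
    let s : Q → G := Quotient.out
    have hs : ∀ q : Q, (s q : Q) = q := fun q => Quotient.out_eq' q
    let k : Q × α → K := fun v => ⟨s v.1 * h v.2 * (s (v.1 * (h v.2 : Q)))⁻¹, by
      rw [← QuotientGroup.eq_one_iff]
      simp [hs]⟩
    let π : α → Q := fun a => (h a : Q)
    -- The factor `2` makes `m` an admissible modulus also when `K` is trivial.
    let m := 2 * Nat.card K
    have hm : 2 ≤ m := Nat.le_mul_of_pos_right 2 Nat.card_pos
    have hexp : ∀ x : K, x ^ m = 1 := fun x => by
      rw [pow_mul', pow_card_eq_one', one_pow]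
    have hcount : IsDefinableLanguage b
        {w | ((prefixTrace π 1 w).map k).prod = (s 1 * g * (s (g : Q))⁻¹ : G)} := by
      refine .of_determined (F := fun (v : Q × α) w => (⟨(prefixTrace π 1 w).count v % m,
        Nat.mod_lt _ (by omega)⟩ : Fin m)) (fun v t => ?_) fun w w' hww hw => ?_
      · refine ((ih Q hQ π v.1).ncard_prefix v.2 hm t.2).congr fun w p => ?_
        rw [Set.mem_ofPred_eq, Fin.ext_iff, ← Prod.mk.eta (p := v), count_prefixTrace]
        simp
      · have := List.prod_map_eq_of_count_mod_eq hexp k (l := prefixTrace π 1 w)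
          (l' := prefixTrace π 1 w') fun v => congrArg Fin.val (hww v)
        rw [Set.mem_ofPred_eq, ← this]
        exact hw
    refine ((ih Q hQ π (g : Q)).and hcount).congr fun w p => ?_
    have hk : (((prefixTrace π 1 w).map k).prod : G) =
        s 1 * (w.map h).prod * (s (((w.map h).prod : G) : Q))⁻¹ := by
      rw [← one_mul (((w.map h).prod : G) : Q), ← prod_prefixTrace K s h 1 w]
      rw [← Subgroup.coe_subtype, map_list_prod, List.map_map]
      rfl
    have hπ : (w.map π).prod = (((w.map h).prod : G) : Q) := by
      rw [← QuotientGroup.mk'_apply, map_list_prod, List.map_map]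
      rfl
    simp only [Set.mem_ofPred_eq, hk, hπ]
    constructor
    · rintro rfl
      exact ⟨rfl, rfl⟩
    · rintro ⟨h1, h2⟩
      rw [h1] at h2
      simpa using h2

theorem isDefinableLanguage_of_isSolvable {α : Type*} [Finite α] (b : Prop)
    {G : Type*} [Group G] [Finite G] [hG : Group.IsSolvable G] (h : α → G) (g : G) :
    IsDefinableLanguage b {w | (w.map h).prod = g} := by
  obtain ⟨n, hn⟩ := hG
  exact isDefinableLanguage_of_derivedSeries_eq_bot b n G hn h g

/-! ### Local divisors -/

section LocalDivisor

variable {M : Type*} [Monoid M]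

/-- The elements `x` with `c * x ∈ M * c`. -/
def localDivisorSubmonoid (c : M) : Submonoid M where
  carrier := {x | ∃ z, c * x = z * c}
  one_mem' := ⟨1, by simp⟩
  mul_mem' := by
    rintro x y ⟨z, hz⟩ ⟨z', hz'⟩
    exact ⟨z * z', by rw [← mul_assoc, hz, mul_assoc, hz', mul_assoc]⟩

/-- Two elements are identified if they have the same image under left multiplication by `c`. -/
def localDivisorCon (c : M) : Con (localDivisorSubmonoid c) where
  r x y := c * (x : M) = c * y
  iseqv := ⟨fun _ => rfl, fun h => h.symm, fun h k => h.trans k⟩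
  mul' := by
    rintro ⟨x, z, hz⟩ ⟨y, hy⟩ ⟨x', hx'⟩ ⟨y', hy'⟩ (h : c * x = c * y) (k : c * x' = c * y')
    change c * (x * x') = c * (y * y')
    rw [← mul_assoc, ← mul_assoc, ← h, hz, mul_assoc, mul_assoc, k]

/-- The local divisor of `M` at `c`. Its underlying set is `c * M ∩ M * c`, through `x ↦ c * x`; it
is encoded as a quotient of a submonoid of `M`. -/
abbrev LocalDivisor (c : M) : Type _ := (localDivisorCon c).Quotient

namespace LocalDivisor

variable {c : M}

/-- The element `c * x` of `c * M ∩ M * c` that corresponds to the class of `x`. -/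
def val (x : LocalDivisor c) : M :=
  Con.liftOn x (fun y => c * (y : M)) fun _ _ h => h

/-- The element `c * t * c` of the local divisor. -/
def of (c t : M) : LocalDivisor c :=
  ((⟨t * c, c * t, (mul_assoc _ _ _).symm⟩ : localDivisorSubmonoid c) : (localDivisorCon c).Quotient)

theorem val_injective : Function.Injective (val : LocalDivisor c → M) := by
  intro x y
  induction x, y using Con.induction_on₂ with
  | _ x y => exact fun h => (Con.eq _).2 h

theorem val_prod_map_of (l : List M) :
    val ((l.map (of c)).prod) = c * (l.map (· * c)).prod := by
  have : (l.map (of c)).prod = (((l.map fun t =>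
      (⟨t * c, c * t, (mul_assoc _ _ _).symm⟩ : localDivisorSubmonoid c)).prod :
        localDivisorSubmonoid c) : (localDivisorCon c).Quotient) := by
    rw [← Con.coe_mk', map_list_prod, List.map_map]
    rfl
  rw [this]
  change c * ((localDivisorSubmonoid c).subtype _) = _
  rw [map_list_prod, List.map_map]
  rfl

theorem card_lt [Finite M] (hc : ¬ IsUnit c) : Nat.card (LocalDivisor c) < Nat.card M := by
  have : Finite (LocalDivisor c) := Finite.of_injective _ val_injective
  have := Fintype.ofFinite M
  have := Fintype.ofFinite (LocalDivisor c)
  rw [Nat.card_eq_fintype_card, Nat.card_eq_fintype_card]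
  refine Fintype.card_lt_of_injective_of_notMem val val_injective (b := 1) ?_
  rintro ⟨x, hx⟩
  induction x using Con.induction_on with
  | _ x => exact hc (IsUnit.of_mul_eq_one _ hx)

theorem hasSolvableSubgroups [Finite M] (h : HasSolvableSubgroups M) :
    HasSolvableSubgroups (LocalDivisor c) :=
  (h.submonoid (localDivisorSubmonoid c)).of_surjective (localDivisorCon c).mk' Con.mk'_surjective

end LocalDivisor

end LocalDivisor

/-! ### Factorization of words at a letter -/

theorem List.append_cons_left_cancel {α : Type*} {c : α} {u u' v v' : List α} (hu : c ∉ u)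
    (hu' : c ∉ u') (h : u ++ c :: v = u' ++ c :: v') : u = u' := by
  induction u generalizing u' with
  | nil => cases u' <;> simp_all
  | cons a u ih =>
    cases u' with
    | nil => simp_all
    | cons a' u' =>
      simp only [List.mem_cons, not_or, List.cons_append, List.cons.injEq] at *
      exact ⟨h.1, ih hu.2 hu'.2 h.2⟩

section Blocks

variable {α M : Type*} [Monoid M]

theorem exists_markedFactorization_iff {w : List α} {c : α} {S S' : Set (List α)} :
    (∃ x : Fin w.length, w.get x = c ∧ w.take x ∈ S ∧ w.drop (x + 1) ∈ S') ↔
      ∃ u ∈ S, ∃ v ∈ S', w = u ++ c :: v := by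
  constructor
  · rintro ⟨x, rfl, h1, h2⟩
    refine ⟨_, h1, _, h2, ?_⟩
    rw [List.get_eq_getElem, List.cons_getElem_drop_succ, List.take_append_drop]
  · rintro ⟨u, hu, v, hv, rfl⟩
    exact ⟨⟨u.length, by simp⟩, by simp, by simpa using hu, by simpa using hv⟩

open Classical in
/-- The label that the transduction assigns to the letter `a` in front of the suffix `v`: if `a = c`
and `c` occurs in `v`, the value of the part of `v` in front of its first `c`. -/
noncomputable def blockLabel (h : α → M) (c a : α) (v : List α) : Option M :=
  if a = c ∧ c ∈ v then some ((v.takeWhile fun x => x ≠ c).map h).prod else none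

theorem blockLabel_of_ne (h : α → M) {c a : α} (hac : a ≠ c) (v : List α) :
    blockLabel h c a v = none :=
  if_neg fun hh => hac hh.1

theorem blockLabel_of_notMem (h : α → M) {c : α} (a : α) {v : List α} (hv : c ∉ v) :
    blockLabel h c a v = none :=
  if_neg fun hh => hv hh.2

theorem blockLabel_append_cons (h : α → M) {c : α} {u : List α} (hu : c ∉ u) (v : List α) :
    blockLabel h c c (u ++ c :: v) = some (u.map h).prod := by
  classical
  have : (u ++ c :: v).takeWhile (fun x => x ≠ c) = u := by
    rw [List.takeWhile_append_of_pos]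
    · simp
    · intro a ha
      simpa using fun e : a = c => hu (e ▸ ha)
  rw [blockLabel, if_pos ⟨rfl, by simp⟩]
  simp only [decide_not] at this ⊢
  rw [← this]
  congr!

theorem blockLabel_eq_some_iff (h : α → M) {c a : α} {v : List α} {t : M} :
    blockLabel h c a v = some t ↔
      a = c ∧ ∃ u v', v = u ++ c :: v' ∧ c ∉ u ∧ (u.map h).prod = t := by
  constructor
  · intro hh
    have hac : a = c := by
      by_contra hac
      simp [blockLabel_of_ne h hac] at hh
    have hcv : c ∈ v := by
      by_contra hcv
      simp [blockLabel_of_notMem h a hcv] at hh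
    obtain ⟨u, v', rfl, hu⟩ := List.eq_append_cons_of_mem hcv
    subst hac
    rw [blockLabel_append_cons h hu] at hh
    exact ⟨rfl, u, v', rfl, hu, Option.some.inj hh⟩
  · rintro ⟨rfl, u, v', rfl, hu, rfl⟩
    exact blockLabel_append_cons h hu v'

/-- Every word that contains `c` is cut by its occurrences of `c` into blocks without `c`. -/
theorem exists_blocks {c : α} {w : List α} (hw : c ∈ w) :
    ∃ (u : List α) (B : List (List α)) (s : List α), c ∉ u ∧ (∀ v ∈ B, c ∉ v) ∧ c ∉ s ∧
      w = u ++ (B.flatMap (c :: ·) ++ c :: s) := by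
  have key : ∀ w : List α, ∃ (u : List α) (B : List (List α)), c ∉ u ∧ (∀ v ∈ B, c ∉ v) ∧
      w = u ++ B.flatMap (c :: ·) := by
    intro w
    induction w with
    | nil => exact ⟨[], [], by simp⟩
    | cons a w ih =>
      obtain ⟨u, B, hu, hB, rfl⟩ := ih
      by_cases hac : a = c
      · subst hac
        exact ⟨[], u :: B, by simp, by simpa using ⟨hu, hB⟩, by simp⟩
      · exact ⟨a :: u, B, by simp [Ne.symm hac, hu], hB, by simp⟩
  obtain ⟨u, B, hu, hB, rfl⟩ := key w
  rcases List.eq_nil_or_concat B with rfl | ⟨B, s, rfl⟩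
  · simp [hu] at hw
  · exact ⟨u, B, s, hu, fun v hv => hB v (by simp [hv]), hB s (by simp), by simp⟩

theorem suffixTransduction_append (h : α → M) {c : α} {u : List α} (hu : c ∉ u) (v : List α) :
    suffixTransduction (blockLabel h c) (u ++ v) = suffixTransduction (blockLabel h c) v := by
  induction u with
  | nil => rfl
  | cons a u ih =>
    rw [List.mem_cons, not_or] at hu
    simp [suffixTransduction, blockLabel_of_ne h (Ne.symm hu.1), ih hu.2]

theorem suffixTransduction_blocks (h : α → M) {c : α} {B : List (List α)} {s : List α}
    (hB : ∀ v ∈ B, c ∉ v) (hs : c ∉ s) :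
    suffixTransduction (blockLabel h c) (B.flatMap (c :: ·) ++ c :: s) =
      B.map fun v => (v.map h).prod := by
  induction B with
  | nil =>
    have := suffixTransduction_append h hs []
    simp only [List.append_nil] at this
    simp [suffixTransduction, blockLabel_of_notMem h c hs, this]
  | cons u B ih =>
    have hu : c ∉ u := hB u (by simp)
    have ih := ih fun v hv => hB v (by simp [hv])
    obtain ⟨v, hv⟩ : ∃ v, B.flatMap (c :: ·) ++ c :: s = c :: v := by
      cases B with
      | nil => exact ⟨s, rfl⟩
      | cons u' B => exact ⟨_, rfl⟩
    rw [List.flatMap_cons, List.append_assoc, hv, List.map_cons, ← ih, hv, List.cons_append,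
      suffixTransduction, blockLabel_append_cons h hu, suffixTransduction_append h hu]
    rfl

/-- The product `h c * h v₁ * h c * ⋯ * h vₖ * h c` is the element of `h c * M ∩ M * h c` that is the
product of the values of the blocks `v₁, …, vₖ` in the local divisor. -/
theorem map_prod_blocks (h : α → M) (c : α) (u : List α) (B : List (List α)) (s : List α) :
    ((u ++ (B.flatMap (c :: ·) ++ c :: s)).map h).prod =
      (u.map h).prod *
        LocalDivisor.val (((B.map fun v => (v.map h).prod).map (LocalDivisor.of (h c))).prod) *
        (s.map h).prod := by
  rw [LocalDivisor.val_prod_map_of]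
  have : ((B.flatMap (c :: ·)).map h).prod * h c =
      h c * ((B.map fun v => (v.map h).prod).map (· * h c)).prod := by
    induction B with
    | nil => simp
    | cons v B ih =>
      simp only [List.flatMap_cons, List.map_append, List.prod_append, mul_assoc, ih]
      simp [mul_assoc]
  rw [← this]
  simp [mul_assoc]

/-- For a word containing `c`, the three factors of `map_prod_blocks` are read off from the block in
front of the first `c`, the transduction, and the block behind the last `c`. -/
theorem map_prod_eq_iff (h : α → M) {c : α} {w : List α} (hw : c ∈ w) (m : M) :
    (w.map h).prod = m ↔ ∃ x : M × LocalDivisor (h c) × M, x.1 * x.2.1.val * x.2.2 = m ∧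
      (∃ u ∈ {u | c ∉ u ∧ (u.map h).prod = x.1}, ∃ v ∈ Set.univ, w = u ++ c :: v) ∧
      (∃ v ∈ Set.univ, ∃ s ∈ {s | c ∉ s ∧ (s.map h).prod = x.2.2}, w = v ++ c :: s) ∧
      ((suffixTransduction (blockLabel h c) w).map (LocalDivisor.of (h c))).prod = x.2.1 := by
  obtain ⟨u, B, s, hu, hB, hs, rfl⟩ := exists_blocks hw
  have hu' : ∃ v, u ++ (B.flatMap (c :: ·) ++ c :: s) = u ++ c :: v := by
    cases B with
    | nil => exact ⟨s, rfl⟩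
    | cons u' B => exact ⟨_, rfl⟩
  rw [map_prod_blocks, suffixTransduction_append h hu, suffixTransduction_blocks h hB hs]
  constructor
  · intro hm
    obtain ⟨v, hv⟩ := hu'
    exact ⟨((u.map h).prod, _, (s.map h).prod), hm, ⟨u, ⟨hu, rfl⟩, v, trivial, hv⟩,
      ⟨u ++ B.flatMap (c :: ·), trivial, s, ⟨hs, rfl⟩, by simp⟩, rfl⟩
  · rintro ⟨⟨x, y, z⟩, rfl, ⟨u', ⟨hu1, hu2⟩, v', -, h1⟩, ⟨v'', -, s', ⟨hs1, hs2⟩, h2⟩, h3⟩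
    obtain ⟨v, hv⟩ := hu'
    have huu : u = u' := List.append_cons_left_cancel hu hu1 (hv.symm.trans h1)
    have hss : s = s' := by
      rw [← List.append_assoc] at h2
      have h2 := congrArg List.reverse h2
      simp only [List.reverse_append, List.reverse_cons, List.append_assoc, List.cons_append,
        List.nil_append] at h2
      exact List.reverse_injective
        (List.append_cons_left_cancel (by simpa using hs) (by simpa using hs1) h2)
    subst huu hss
    rw [← hu2, ← hs2, ← h3]

end Blocks

/-! ### Languages recognized by monoids with solvable subgroups -/

/-- If a letter `c` is not mapped to a unit, the values of the blocks without `c` are definable by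
induction on the number of such letters, and the product from the first to the last `c` is definable
by induction on the size of the monoid, applied to the local divisor at `h c`. -/
theorem isDefinableLanguage_of_hasSolvableSubgroups {α M : Type u} [Finite α] [Monoid M] [Finite M]
    (hM : HasSolvableSubgroups M) (h : α → M) (m : M) :
    IsDefinableLanguage False {w | (w.map h).prod = m} := by
  -- Outer induction on the size of the monoid, inner induction on the number of letters that are
  -- not mapped to units.
  suffices H : ∀ N K : ℕ, ∀ (M : Type u) [Monoid M] [Finite M], Nat.card M < N →
      HasSolvableSubgroups M → ∀ (α : Type u) [Finite α] (h : α → M),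
      {a | ¬ IsUnit (h a)}.ncard < K → ∀ m, IsDefinableLanguage False {w | (w.map h).prod = m} from
    H _ _ M (Nat.lt_succ_self _) hM α h (Nat.lt_succ_self _) m
  intro N
  induction N with
  | zero => intro K M _ _ hN; omega
  | succ N ihN =>
  intro K
  induction K with
  | zero => intro M _ _ _ _ α _ h hK; omega
  | succ K ihK =>
  intro M _ _ hN hM α _ h hK m
  classical
  by_cases hu : ∀ a, IsUnit (h a)
  · have : Group.IsSolvable Mˣ :=
      hM.isSolvable (Units.coeHom M : Mˣ →ₙ* M) Units.val_injective
    refine (IsDefinable.exists_finite fun u : Mˣ => (IsDefinable.const False ((u : M) = m)).and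
      (isDefinableLanguage_of_isSolvable False (fun a => (hu a).unit) u)).congr fun w p => ?_
    have hw : (((w.map fun a => (hu a).unit).prod : Mˣ) : M) = (w.map h).prod := by
      rw [← Units.coeHom_apply, map_list_prod, List.map_map]
      rfl
    constructor
    · rintro rfl
      exact ⟨_, hw, rfl⟩
    · rintro ⟨u, rfl, rfl⟩
      exact hw.symm
  · push Not at hu
    obtain ⟨c, hc⟩ := hu
    -- Words without `c` do not see the difference between `h` and the map that sends `c` to `1`.
    let h' : α → M := Function.update h c 1
    have hh' : ∀ w : List α, c ∉ w → w.map h' = w.map h := fun w hw =>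
      List.map_congr_left fun a ha =>
        Function.update_of_ne (fun e : a = c => hw (e ▸ ha)) _ _
    have hcard : {a | ¬ IsUnit (h' a)}.ncard < K := by
      refine lt_of_lt_of_le (Set.ncard_lt_ncard ⟨fun a ha => ?_, fun hsub => ?_⟩)
        (Nat.lt_succ_iff.1 hK)
      · by_cases hac : a = c
        · exact hac ▸ hc
        · simpa [h', Function.update_of_ne hac] using ha
      · exact hsub hc (by simp [h'])
    have hfree : IsDefinableLanguage False {w : List α | c ∉ w} :=
      (IsDefinable.ex not_false (IsDefinable.letter False c 0)).not.congr fun w p => by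
        simp [Fin.snoc, List.mem_iff_get]
    have hblock : ∀ t, IsDefinableLanguage False {w : List α | c ∉ w ∧ (w.map h).prod = t} :=
      fun t => (hfree.and (ihK M hN hM α h' hcard t)).congr fun w p =>
        and_congr_right fun hw => by
          change _ ↔ (w.map h').prod = t
          rw [hh' w hw]
    have huniv : IsDefinableLanguage False (Set.univ : Set (List α)) :=
      (IsDefinable.const False True).congr fun w p => Iff.rfl
    have hfirst : ∀ t, IsDefinableLanguage False
        {w : List α | ∃ u ∈ {u | c ∉ u ∧ (u.map h).prod = t}, ∃ v ∈ Set.univ, w = u ++ c :: v} :=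
      fun t => ((hblock t).markedProduct not_false c huniv).congr fun w p =>
        exists_markedFactorization_iff.symm
    have hlast : ∀ t, IsDefinableLanguage False
        {w : List α | ∃ v ∈ Set.univ, ∃ s ∈ {s | c ∉ s ∧ (s.map h).prod = t}, w = v ++ c :: s} :=
      fun t => (huniv.markedProduct not_false c (hblock t)).congr fun w p =>
        exists_markedFactorization_iff.symm
    have : Finite (LocalDivisor (h c)) := Finite.of_injective _ LocalDivisor.val_injective
    have hmiddle : ∀ y, IsDefinableLanguage False
        {w | ((suffixTransduction (blockLabel h c) w).map (LocalDivisor.of (h c))).prod = y} := by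
      intro y
      refine IsDefinableLanguage.suffixTransduction
        (ihN _ (LocalDivisor (h c)) (by have := LocalDivisor.card_lt hc; omega)
          (LocalDivisor.hasSolvableSubgroups hM) M (LocalDivisor.of (h c)) (Nat.lt_succ_self _) y)
        fun t => ((IsDefinable.letter False c 0).and (hfirst t).drop).congr fun w p => ?_
      rw [blockLabel_eq_some_iff]
      refine and_congr_right fun _ => ?_
      simp only [Set.mem_ofPred_eq, Set.mem_univ, true_and]
      exact ⟨fun ⟨u, v, e, hu, ht⟩ => ⟨u, ⟨hu, ht⟩, v, e⟩,
        fun ⟨u, ⟨hu, ht⟩, v, e⟩ => ⟨u, v, e, hu, ht⟩⟩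
    refine ((hblock m).or (hfree.not.and (IsDefinable.exists_finite
      fun x : M × LocalDivisor (h c) × M => (IsDefinable.const False
        (x.1 * x.2.1.val * x.2.2 = m)).and
        ((hfirst x.1).and ((hlast x.2.2).and (hmiddle x.2.1)))))).congr fun w p => ?_
    by_cases hw : c ∈ w
    · have := map_prod_eq_iff h hw m
      simp only [Set.mem_ofPred_eq, hw, not_true_eq_false, false_and, false_or, not_false_eq_true,
        true_and] at this ⊢
      exact this
    · simp [hw]

/-! ### Syntactic monoids of definable languages -/

theorem isDefinableLanguage_of_syntacticMonoid {α : Type*} {L : Language α} {b : Prop}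
    [Finite (SyntacticMonoid L)]
    (h : ∀ m : SyntacticMonoid L, IsDefinableLanguage b
      {w | (w.map fun a => (syntacticCon L).mk' (FreeMonoid.of a)).prod = m}) :
    IsDefinableLanguage b {w | w ∈ L} := by
  have hprod : ∀ w : List α, (w.map fun a => (syntacticCon L).mk' (FreeMonoid.of a)).prod =
      (syntacticCon L).mk' (FreeMonoid.ofList w) := by
    intro w
    induction w with
    | nil => rfl
    | cons a w ih =>
      rw [List.map_cons, List.prod_cons, ih, FreeMonoid.ofList_cons, map_mul]
  refine (IsDefinable.exists_finite fun m : SyntacticMonoid L =>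
    (IsDefinable.const b (∃ v ∈ L, (syntacticCon L).mk' (FreeMonoid.ofList v) = m)).and
      (h m)).congr fun w p => ?_
  simp only [Set.mem_ofPred_eq, hprod]
  constructor
  · exact fun hw => ⟨_, ⟨w, hw, rfl⟩, rfl⟩
  · rintro ⟨m, ⟨v, hv, rfl⟩, hm⟩
    have hvw : syntacticCon L (FreeMonoid.ofList w) (FreeMonoid.ofList v) := (Con.eq _).1 hm
    have := hvw 1 1
    rw [one_mul, mul_one, one_mul, mul_one] at this
    exact this.2 hv

/-- A finite monoid is a group as soon as every element has a power equal to `1`. -/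
theorem isFiniteSolvableGroup_iff {M : Type*} [Monoid M] :
    IsFiniteSolvableGroup M ↔
      Finite M ∧ HasSolvableSubgroups M ∧ ∀ x : M, IsOfFinOrder x := by
  refine and_congr_right fun _ => ⟨?_, fun ⟨h1, h2⟩ => ?_⟩
  · rintro ⟨G, rfl, hG⟩
    exact ⟨.of_isSolvable, fun x => isOfFinOrder_of_finite x⟩
  · let G : Group M := groupOfIsUnit fun x => (h2 x).isUnit
    exact ⟨G, rfl, h1.isSolvable (MulHom.id M) Function.injective_id⟩

theorem isDefinableLanguage_of_isFiniteSolvableGroup {α M : Type*} [Finite α] [Monoid M] (b : Prop)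
    (hM : IsFiniteSolvableGroup M) (h : α → M) (m : M) :
    IsDefinableLanguage b {w | (w.map h).prod = m} := by
  obtain ⟨_, G, rfl, hG⟩ := hM
  exact isDefinableLanguage_of_isSolvable b h m

theorem isDefinableLanguage_iff {α : Type*} {L : Language α} {b : Prop} :
    IsDefinableLanguage b {w | w ∈ L} ↔ ∃ φ : FOMod α 0, (b → φ.IsMod) ∧ φ.language = L := by
  refine exists_congr fun φ => and_congr_right fun _ => ⟨fun h => ?_, ?_⟩
  · exact Set.ext fun w => h w Fin.elim0
  · rintro rfl w p
    rw [Subsingleton.elim p Fin.elim0]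
    rfl

theorem mainTheorem4 {α : Type*} [Finite α] (L : Language α) :
    (IsFOModDefinable L ↔ IsSolvableMonoid (SyntacticMonoid L)) ∧
      (IsModDefinable L ↔ IsFiniteSolvableGroup (SyntacticMonoid L)) := by
  have hrec : ∀ {b : Prop} {φ : FOMod α 0}, (b → φ.IsMod) → φ.language = L →
      IsRecognized b fun (w : List α) (_ : Fin 0 → Fin w.length) => w ∈ L := by
    rintro b φ hφ rfl
    refine (φ.isRecognized b hφ).congr fun w p => ?_
    rw [Subsingleton.elim p Fin.elim0]
    rfl
  constructor
  · rw [isSolvableMonoid_iff]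
    constructor
    · rintro ⟨φ, hL⟩
      obtain ⟨h1, h2, -⟩ := syntacticMonoid_of_isRecognized (hrec (b := False) False.elim hL)
      exact ⟨h1, h2⟩
    · rintro ⟨h1, h2⟩
      obtain ⟨φ, -, hφ⟩ := isDefinableLanguage_iff.1 (isDefinableLanguage_of_syntacticMonoid
        fun m => isDefinableLanguage_of_hasSolvableSubgroups h2 _ m)
      exact ⟨φ, hφ⟩
  · constructor
    · rintro ⟨φ, hφ, hL⟩
      obtain ⟨h1, h2, h3⟩ := syntacticMonoid_of_isRecognized (hrec (b := True) (fun _ => hφ) hL)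
      exact isFiniteSolvableGroup_iff.2 ⟨h1, h2, h3 trivial⟩
    · intro h
      have := h.1
      obtain ⟨φ, h3, hφ⟩ := isDefinableLanguage_iff.1 (isDefinableLanguage_of_syntacticMonoid
        (b := True) fun m => isDefinableLanguage_of_isFiniteSolvableGroup True h _ m)
      exact ⟨φ, h3 trivial, hφ⟩
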